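/- **Setting.** Let $d,m\ge 1$, let $\mathcal X\subset\{x\in\mathbb R^d:\|x\|\le 1\}$, and let $A\in\mathbb R^{m\times d}$ have rows $A^i$ with $\|A^i\|\le 1$. Write $z^i$ for the $i$-th coordinate of a vector $z$. The instance is *feasible* if some $x\in\mathcal X$ satisfies $Ax\ge 0$ coordinatewise, and *infeasible* if for every $x\in\mathcal X$ there is an $i$ with $(Ax)^i<0$. Its signal level is $\Gamma:=\sup_{x\in\mathcal X}\min_{1\le i\le m}(Ax)^i$. In each round $t=1,2,\dots$ an action $x_t\in\mathcal X$ and an index $i_t\in\{1,\dots,m\}$ are chosen and then $S_t=Ax_t+\zeta_t\in\mathbb R^m$ is observed. There is a filtration $(\mathscr G_t)$ such that $(x_t,i_t)$ and $S_1,\dots,S_{t-1}$ are $\mathscr G_t$-measurable ($\mathscr G_t$ may contain additional algorithmic randomness), and the noise satisfies $\mathbb E[\zeta_t\mid\mathscr G_t]=0$ and $\mathbb E[e^{\lambda^\top\zeta_t}\mid\mathscr G_t]\le e^{\|\lambda\|^2/2}$ a.s. for every $\lambda\in\mathbb R^m$. Let $V_t:=I+\sum_{s<t}x_sx_s^\top$,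 $\hat A_t:=\big(\sum_{s<t}S_sx_s^\top\big)V_t^{-1}$, $\|x\|_{V_t^{-1}}^2:=x^\top V_t^{-1}x$, and $$\mathrm{Rad}_t(x):=\sqrt{t/d}\,\|x\|_{V_t^{-1}}^2+\sqrt{d\,\|x\|_{V_t^{-1}}^2}.$$ The *tempered rule* is: in every round $t$, $x_t$ attains $\max_{x\in\mathcal X}\big\{\min_i(\hat A_tx)^i+\mathrm{Rad}_t(x)\big\}$ and $i_t$ attains $\min_i(\hat A_tx_t)^i$ (ties broken arbitrarily). Put $\widetilde T_t:=\sum_{s\le t}S_s^{i_s}$. For $\delta\in(0,1/2)$ let $\mathrm{LIL}(t,\delta):=\sqrt{4t\log\frac{11\max(\log t,1)}{\delta}}$ and $$Q^F_t(\delta):=45\sqrt{dt\log^4t}\,\big(d+\log(8m/\delta)\big)+\mathrm{LIL}(t,\delta/2),$$ $$Q^I_t(\delta):=27\sqrt{dt\log^3t}\,\big(\sqrt d+\log(8m/\delta)\big)+\mathrm{LIL}(t,\delta/2).$$ **Lemma.** Suppose that the actions and indices are chosen by the tempered rule. Then for every $\delta\in(0,1/2)$: 1. if the instance is feasible, $\mathbb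 P\big(\forall t\ge 1:\ \widetilde T_t\ge t\Gamma-Q^F_t(\delta)\big)\ge 1-\delta$; 2. if the instance is infeasible, $\mathbb P\big(\forall t\ge 1:\ \widetilde T_t\le t\Gamma+Q^I_t(\delta)\big)\ge 1-\delta$; 3. if $m=1$, so that $A=\theta^\top$ and the problem is a linear bandit with parameter $\theta$ (no condition on the sign of $\Gamma$), the pseudoregret $\mathscr R_t:=\sum_{s\le t}\big(\sup_{x\in\mathcal X}\theta^\top x-\theta^\top x_s\big)$ satisfies $$\mathbb P\Big(\forall t\ge 1:\ \mathscr R_t\le 36\,d^{3/2}\sqrt t\,\log^2(t+1)+45\sqrt{dt}\,\log(t+1)\log(8/\delta)\Big)\ge 1-\delta/2 .$$ -/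

import Mathlib

open MeasureTheory

noncomputable section

namespace TemperedTest

/-- The mean score vector `A x ∈ ℝᵐ` of an action `x ∈ ℝᵈ`. -/
def meanScore {m d : ℕ} (A : Matrix (Fin m) (Fin d) ℝ) (x : EuclideanSpace ℝ (Fin d)) :
    EuclideanSpace ℝ (Fin m) :=
  WithLp.toLp 2 (A.mulVec x.ofLp)

/-- `min_i (A x)^i`; the index set is finite. -/
def minScore {m d : ℕ} (A : Matrix (Fin m) (Fin d) ℝ) (x : EuclideanSpace ℝ (Fin d)) : ℝ :=
  ⨅ k : Fin m, meanScore A x k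

/-- The signal level `Γ = max_{x ∈ 𝒳} min_i (A x)^i` (written as a supremum; it is the maximum
whenever the maximum is attained, and the set is bounded for the instances below). -/
def signalLevel {m d : ℕ} (𝒳 : Set (EuclideanSpace ℝ (Fin d)))
    (A : Matrix (Fin m) (Fin d) ℝ) : ℝ :=
  sSup (minScore A '' 𝒳)

/-- The feasibility hypothesis: some action satisfies all the constraints. -/
def Feasible {m d : ℕ} (𝒳 : Set (EuclideanSpace ℝ (Fin d)))
    (A : Matrix (Fin m) (Fin d) ℝ) : Prop :=
  ∃ x ∈ 𝒳, ∀ k, 0 ≤ meanScore A x k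

/-- The infeasibility hypothesis: every action violates some constraint. -/
def Infeasible {m d : ℕ} (𝒳 : Set (EuclideanSpace ℝ (Fin d)))
    (A : Matrix (Fin m) (Fin d) ℝ) : Prop :=
  ∀ x ∈ 𝒳, ∃ k, meanScore A x k < 0

/-- Boundedness of the instance: actions and rows of `A` have Euclidean norm at most one. -/
structure BoundedInstance {m d : ℕ} (𝒳 : Set (EuclideanSpace ℝ (Fin d)))
    (A : Matrix (Fin m) (Fin d) ℝ) : Prop where
  action_norm_le : ∀ x ∈ 𝒳, ‖x‖ ≤ 1
  row_norm_le : ∀ k, ‖(WithLp.toLp 2 (A k) : EuclideanSpace ℝ (Fin d))‖ ≤ 1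

/-- `V_t = I + ∑_{s < t} x_s x_sᵀ`, where rounds are numbered `1, 2, …`. -/
def designMatrix {d : ℕ} (x : ℕ → EuclideanSpace ℝ (Fin d)) (t : ℕ) :
    Matrix (Fin d) (Fin d) ℝ :=
  1 + ∑ s ∈ Finset.Ico 1 t, Matrix.vecMulVec (x s).ofLp (x s).ofLp

/-- The `1`-regularised least squares estimate
`Â_t = (∑_{s < t} S_s x_sᵀ) V_t⁻¹` of `A` from the first `t - 1` rounds. -/
def rlsEstimate {m d : ℕ} (x : ℕ → EuclideanSpace ℝ (Fin d))
    (S : ℕ → EuclideanSpace ℝ (Fin m)) (t : ℕ) : Matrix (Fin m) (Fin d) ℝ :=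
  (∑ s ∈ Finset.Ico 1 t, Matrix.vecMulVec (S s).ofLp (x s).ofLp) * (designMatrix x t)⁻¹

/-- `‖y‖²_{V_t⁻¹} = yᵀ V_t⁻¹ y`. -/
def invNormSq {d : ℕ} (x : ℕ → EuclideanSpace ℝ (Fin d)) (t : ℕ)
    (y : EuclideanSpace ℝ (Fin d)) : ℝ :=
  y.ofLp ⬝ᵥ (designMatrix x t)⁻¹.mulVec y.ofLp

/-- `Rad_t(y) = (t/d)^{1/2} ‖y‖²_{V_t⁻¹} + (d ‖y‖²_{V_t⁻¹})^{1/2}`. -/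
def rad {d : ℕ} (x : ℕ → EuclideanSpace ℝ (Fin d)) (t : ℕ)
    (y : EuclideanSpace ℝ (Fin d)) : ℝ :=
  √((t : ℝ) / d) * invNormSq x t y + √((d : ℝ) * invNormSq x t y)

/-- `(x_t, i_t)` solves `max_{y ∈ 𝒳} min_i (Â_t y)^i + Rad_t(y)` in every round `t ≥ 1`, along one
sequence of actions `x`, measured constraints `i` and scores `S`. -/
def TemperedSelection {m d : ℕ} (𝒳 : Set (EuclideanSpace ℝ (Fin d)))
    (x : ℕ → EuclideanSpace ℝ (Fin d)) (i : ℕ → Fin m)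
    (S : ℕ → EuclideanSpace ℝ (Fin m)) : Prop :=
  ∀ t, 1 ≤ t →
    x t ∈ 𝒳 ∧
    (∀ y ∈ 𝒳, minScore (rlsEstimate x S t) y + rad x t y ≤
      minScore (rlsEstimate x S t) (x t) + rad x t (x t)) ∧
    (∀ k, meanScore (rlsEstimate x S t) (x t) (i t) ≤ meanScore (rlsEstimate x S t) (x t) k)

/-- The noise `ζ_t = S_t - A x_t`. -/
def noise {Ω : Type*} {m d : ℕ} (A : Matrix (Fin m) (Fin d) ℝ)
    (x : ℕ → Ω → EuclideanSpace ℝ (Fin d)) (S : ℕ → Ω → EuclideanSpace ℝ (Fin m))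
    (t : ℕ) (ω : Ω) : EuclideanSpace ℝ (Fin m) :=
  S t ω - meanScore A (x t ω)

/-- The interaction protocol. `𝒢 t` is the information available just before the score of
round `t` is observed: it contains the past actions and scores, the choice `(x_t, i_t)`, and possibly
further (algorithmic) randomness. Given it, the noise of round `t` is centred and
`1`-subGaussian. The integrability in `exp_integrable` is what finiteness of the conditional
exponential moments means. -/
structure BanditInteraction {Ω : Type*} [mΩ : MeasurableSpace Ω] {m d : ℕ} (μ : Measure Ω)
    (𝒢 : Filtration ℕ mΩ) (A : Matrix (Fin m) (Fin d) ℝ)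
    (x : ℕ → Ω → EuclideanSpace ℝ (Fin d)) (i : ℕ → Ω → Fin m)
    (S : ℕ → Ω → EuclideanSpace ℝ (Fin m)) : Prop where
  action_measurable : ∀ t, 1 ≤ t → Measurable[𝒢 t] (x t)
  constraint_measurable : ∀ t, 1 ≤ t → Measurable[𝒢 t] (i t)
  score_measurable : ∀ s t, 1 ≤ s → s < t → Measurable[𝒢 t] (S s)
  noise_centred : ∀ t, 1 ≤ t → μ[noise A x S t | 𝒢 t] =ᵐ[μ] 0
  exp_integrable : ∀ t, 1 ≤ t → ∀ l : EuclideanSpace ℝ (Fin m),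
    Integrable (fun ω => Real.exp (inner ℝ l (noise A x S t ω))) μ
  noise_subGaussian : ∀ t, 1 ≤ t → ∀ l : EuclideanSpace ℝ (Fin m),
    μ[fun ω => Real.exp (inner ℝ l (noise A x S t ω)) | 𝒢 t] ≤ᵐ[μ]
      fun _ => Real.exp (‖l‖ ^ 2 / 2)

/-- The statistic `T̃_t = ∑_{s ≤ t} S_s^{i_s}`. -/
def statistic {m : ℕ} (i : ℕ → Fin m) (S : ℕ → EuclideanSpace ℝ (Fin m)) (t : ℕ) : ℝ :=
  ∑ s ∈ Finset.Icc 1 t, S s (i s)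

/-- The pseudoregret `∑_{s ≤ t} (max_{y ∈ 𝒳} θᵀ y - θᵀ x_s)` of a linear bandit with
parameter `θ`. -/
def pseudoRegret {d : ℕ} (𝒳 : Set (EuclideanSpace ℝ (Fin d))) (θ : Fin d → ℝ)
    (x : ℕ → EuclideanSpace ℝ (Fin d)) (t : ℕ) : ℝ :=
  ∑ s ∈ Finset.Icc 1 t,
    (sSup ((fun y : EuclideanSpace ℝ (Fin d) => θ ⬝ᵥ y.ofLp) '' 𝒳) - θ ⬝ᵥ (x s).ofLp)

/-- `LIL(t, δ) = √(4 t log(11 max(log t, 1) / δ))`. -/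
def lil (t : ℕ) (δ : ℝ) : ℝ :=
  √(4 * t * Real.log (11 * max (Real.log t) 1 / δ))

/-- The boundary used for feasible instances. -/
def boundaryF (m d t : ℕ) (δ : ℝ) : ℝ :=
  45 * √((d : ℝ) * t * Real.log t ^ 4) * (d + Real.log (8 * m / δ)) + lil t (δ / 2)

/-- The boundary used for infeasible instances. -/
def boundaryI (m d t : ℕ) (δ : ℝ) : ℝ :=
  27 * √((d : ℝ) * t * Real.log t ^ 3) * (√(d : ℝ) + Real.log (8 * m / δ)) + lil t (δ / 2)

end TemperedTest

end

open Matrix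

namespace TemperedTest

/-! ### Rank one updates of positive definite matrices -/

section RankOne

variable {d : ℕ} {V : Matrix (Fin d) (Fin d) ℝ}

/-! Confidence. For one noise coordinate let W_t = ∑_{s<t} ζ_s x_s. Then exp(‖W_t‖²_{V_t⁻¹}/2)/√(det
V_t) is a nonnegative supermartingale started at 1. Ville's inequality (`mul_measure_exists_ge_le`)
and a union over the m coordinates show that, outside an event of probability δ/8
(`BanditInteraction.measure_not_confident_le`), for all t, all s ≤ t and all y, the estimated scores
of y in round s are within b‖y‖_{V_s⁻¹} of the true ones, with b = 1 + √(d log(t+1) + 2 log(8m/δ))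
(`Confident.abs_sub_le`).

Tempered optimism. The rule does not know b, but b·u ≤ √(t/d)·u² + b²√d/(4√t) by completing the
square, so the radius beats every linear width up to an error that does not depend on the action
(`mul_sqrt_le_rad_add`). Hence Γ - (A x_t)^{i_t} is at most the radius at x_t, plus one width, plus
this error. The elliptical potential lemma `sum_invNormSq_le` sums the first two, and the errors sum
to order b²√(dt). In the opposite direction optimism plays no role: i_t minimises the estimated
scores and min_i (A x_t)^i ≤ Γ, so the excess is at most two widths.

Noise. The statistic is ∑ (A x_s)^{i_s} plus a sum of scalar noises, each conditionally subGaussian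
because i_s is predictable. A Chernoff bound at every t and a union over t cost 7δ/8
(`measure_exists_noiseThreshold_le`). These crude logarithms suffice: for t ≥ 2 the leading boundary
term absorbs everything, and the LIL term is needed only at t = 1, where log t = 0. The pseudoregret
contains no noise, so the confidence event alone controls it. -/

lemma posSemidef_vecMulVec_self (x : Fin d → ℝ) : (vecMulVec x x).PosSemidef := by
  simpa using posSemidef_vecMulVec_self_star x

lemma dotProduct_mulVec_inv_nonneg (hV : V.PosDef) (y : Fin d → ℝ) : 0 ≤ y ⬝ᵥ V⁻¹ *ᵥ y := by
  simpa using hV.inv.posSemidef.dotProduct_mulVec_nonneg y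

lemma dotProduct_mulVec_inv_comm (hV : V.PosDef) (y z : Fin d → ℝ) :
    y ⬝ᵥ V⁻¹ *ᵥ z = z ⬝ᵥ V⁻¹ *ᵥ y := by
  have h : (V⁻¹)ᵀ = V⁻¹ := by simpa using hV.inv.isHermitian.eq
  rw [dotProduct_mulVec, ← mulVec_transpose, h, dotProduct_comm]

/-- The Cauchy-Schwarz inequality for the inner product given by `V⁻¹`. -/
lemma sq_dotProduct_mulVec_inv_le (hV : V.PosDef) (y z : Fin d → ℝ) :
    (y ⬝ᵥ V⁻¹ *ᵥ z) ^ 2 ≤ (y ⬝ᵥ V⁻¹ *ᵥ y) * (z ⬝ᵥ V⁻¹ *ᵥ z) := by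
  have h := discrim_le_zero (a := z ⬝ᵥ V⁻¹ *ᵥ z) (b := 2 * (y ⬝ᵥ V⁻¹ *ᵥ z))
    (c := y ⬝ᵥ V⁻¹ *ᵥ y) fun r => by
      have h := dotProduct_mulVec_inv_nonneg hV (y + r • z)
      simp only [mulVec_add, mulVec_smul, add_dotProduct, dotProduct_add, smul_dotProduct,
        dotProduct_smul, smul_eq_mul, dotProduct_mulVec_inv_comm hV z y] at h
      linarith
  rw [discrim] at h
  linarith

lemma abs_dotProduct_mulVec_inv_le (hV : V.PosDef) (y z : Fin d → ℝ) :
    |y ⬝ᵥ V⁻¹ *ᵥ z| ≤ √(y ⬝ᵥ V⁻¹ *ᵥ y) * √(z ⬝ᵥ V⁻¹ *ᵥ z) := by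
  rw [← Real.sqrt_mul (dotProduct_mulVec_inv_nonneg hV y)]
  exact Real.abs_le_sqrt (sq_dotProduct_mulVec_inv_le hV y z)

/-- The Sherman-Morrison formula. -/
lemma dotProduct_mulVec_inv_add_vecMulVec (hV : V.PosDef) (x y z : Fin d → ℝ) :
    y ⬝ᵥ (V + vecMulVec x x)⁻¹ *ᵥ z = y ⬝ᵥ V⁻¹ *ᵥ z -
      (y ⬝ᵥ V⁻¹ *ᵥ x) * (x ⬝ᵥ V⁻¹ *ᵥ z) / (1 + x ⬝ᵥ V⁻¹ *ᵥ x) := by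
  have hq : 1 + x ⬝ᵥ V⁻¹ *ᵥ x ≠ 0 := by
    have := dotProduct_mulVec_inv_nonneg hV x
    positivity
  have hdet : IsUnit V.det := hV.det_pos.ne'.isUnit
  have h : (V + vecMulVec x x)⁻¹ *ᵥ z =
      V⁻¹ *ᵥ z - ((x ⬝ᵥ V⁻¹ *ᵥ z) / (1 + x ⬝ᵥ V⁻¹ *ᵥ x)) • V⁻¹ *ᵥ x := by
    have hdet' : IsUnit (V + vecMulVec x x).det :=
      (hV.add_posSemidef (posSemidef_vecMulVec_self x)).det_pos.ne'.isUnit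
    have hz : (V + vecMulVec x x) *ᵥ
        (V⁻¹ *ᵥ z - ((x ⬝ᵥ V⁻¹ *ᵥ z) / (1 + x ⬝ᵥ V⁻¹ *ᵥ x)) • V⁻¹ *ᵥ x) = z := by
      have hw (w : Fin d → ℝ) :
          (V + vecMulVec x x) *ᵥ (V⁻¹ *ᵥ w) = w + (x ⬝ᵥ V⁻¹ *ᵥ w) • x := by
        rw [add_mulVec, mulVec_mulVec, mul_nonsing_inv _ hdet, one_mulVec, vecMulVec_mulVec,
          op_smul_eq_smul]
      rw [mulVec_sub, mulVec_smul, hw, hw]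
      ext j
      simp only [Pi.add_apply, Pi.sub_apply, Pi.smul_apply, smul_eq_mul]
      field_simp
      ring
    -- `← hz` also expands the occurrences of `z` on the right; the final `hz` folds them back.
    rw [← hz, mulVec_mulVec, nonsing_inv_mul _ hdet', one_mulVec, hz]
  rw [h, dotProduct_sub, dotProduct_smul, smul_eq_mul]
  ring

lemma det_add_vecMulVec (hV : V.PosDef) (x : Fin d → ℝ) :
    (V + vecMulVec x x).det = V.det * (1 + x ⬝ᵥ V⁻¹ *ᵥ x) := by
  rw [vecMulVec_eq Unit, det_add_replicateCol_mul_replicateRow hV.det_pos.ne'.isUnit]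
  congr 1
  simp [Matrix.mul_apply, replicateRow, replicateCol, dotProduct, mulVec, Finset.sum_mul,
    Finset.mul_sum, mul_assoc]
  exact Finset.sum_comm

/-- The logarithm of the determinant is bounded through the trace. -/
lemma log_det_le_of_trace_le (hV : V.PosDef) {r : ℝ} (hr : 0 < r) (h : V.trace ≤ d * r) :
    Real.log V.det ≤ d * Real.log r := by
  have hpos := hV.eigenvalues_pos
  rw [hV.isHermitian.det_eq_prod_eigenvalues]
  rw [hV.isHermitian.trace_eq_sum_eigenvalues] at h
  simp only [RCLike.ofReal_real_eq_id, id_eq] at h ⊢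
  rw [Real.log_prod fun j _ => (hpos j).ne']
  calc ∑ j, Real.log (hV.isHermitian.eigenvalues j)
      ≤ ∑ j, (hV.isHermitian.eigenvalues j / r - 1 + Real.log r) := by
        gcongr with j
        -- The tangent of log at `r`, applied to each eigenvalue, takes the place of AM-GM.
        have := Real.log_le_sub_one_of_pos (div_pos (hpos j) hr)
        rw [Real.log_div (hpos j).ne' hr.ne'] at this
        linarith
    _ = (∑ j, hV.isHermitian.eigenvalues j) / r - d + d * Real.log r := by
        simp [Finset.sum_add_distrib, Finset.sum_sub_distrib, Finset.sum_div]
    _ ≤ d * Real.log r := by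
        have := (div_le_iff₀ hr).2 h
        linarith

end RankOne

/-! ### The design matrix -/

section Design

variable {d : ℕ} (x : ℕ → EuclideanSpace ℝ (Fin d))

lemma designMatrix_one : designMatrix x 1 = 1 := by simp [designMatrix]

lemma designMatrix_succ {t : ℕ} (ht : 1 ≤ t) :
    designMatrix x (t + 1) = designMatrix x t + vecMulVec (x t).ofLp (x t).ofLp := by
  rw [designMatrix, Finset.sum_Ico_succ_top ht, designMatrix, add_assoc]

lemma posDef_designMatrix (t : ℕ) : (designMatrix x t).PosDef :=
  PosDef.one.add_posSemidef (posSemidef_sum _ fun _ _ => posSemidef_vecMulVec_self _)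

lemma invNormSq_nonneg (t : ℕ) (y : EuclideanSpace ℝ (Fin d)) : 0 ≤ invNormSq x t y :=
  dotProduct_mulVec_inv_nonneg (posDef_designMatrix x t) _

lemma dotProduct_self_eq_norm_sq (y : EuclideanSpace ℝ (Fin d)) : y.ofLp ⬝ᵥ y.ofLp = ‖y‖ ^ 2 := by
  rw [EuclideanSpace.real_norm_sq_eq]
  simp [dotProduct, sq]

/-- By Sherman-Morrison each round only subtracts a square from the width, which starts at V_1 = I.
-/
lemma invNormSq_le_norm_sq {t : ℕ} (ht : 1 ≤ t) (y : EuclideanSpace ℝ (Fin d)) :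
    invNormSq x t y ≤ ‖y‖ ^ 2 := by
  induction t, ht using Nat.le_induction with
  | base => simp [invNormSq, designMatrix_one, dotProduct_self_eq_norm_sq]
  | succ t ht ih =>
    refine le_trans ?_ ih
    rw [invNormSq, designMatrix_succ x ht,
      dotProduct_mulVec_inv_add_vecMulVec (posDef_designMatrix x t),
      dotProduct_mulVec_inv_comm (posDef_designMatrix x t) (x t).ofLp y.ofLp]
    have := invNormSq_nonneg x t (x t)
    rw [invNormSq] at this
    rw [invNormSq, sub_le_self_iff]
    exact div_nonneg (mul_self_nonneg _) (by linarith)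

lemma det_designMatrix_succ {t : ℕ} (ht : 1 ≤ t) :
    (designMatrix x (t + 1)).det = (designMatrix x t).det * (1 + invNormSq x t (x t)) := by
  rw [designMatrix_succ x ht, det_add_vecMulVec (posDef_designMatrix x t), invNormSq]

variable {x}

/-- The trace is at most d + (t - 1) ≤ d·t, so the trace bound applies with mean eigenvalue `t`. -/
lemma log_det_designMatrix_le (hd : 1 ≤ d) (hx : ∀ s, 1 ≤ s → ‖x s‖ ≤ 1) {t : ℕ} (ht : 1 ≤ t) :
    Real.log (designMatrix x t).det ≤ d * Real.log t := by
  have ht' : (1 : ℝ) ≤ t := by exact_mod_cast ht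
  have hd' : (1 : ℝ) ≤ d := by exact_mod_cast hd
  refine log_det_le_of_trace_le (posDef_designMatrix x t) (by linarith) ?_
  have : ∑ s ∈ Finset.Ico 1 t, (x s).ofLp ⬝ᵥ (x s).ofLp ≤ ∑ s ∈ Finset.Ico 1 t, (1 : ℝ) := by
    refine Finset.sum_le_sum fun s hs => ?_
    rw [dotProduct_self_eq_norm_sq]
    exact pow_le_one₀ (norm_nonneg _) (hx s (Finset.mem_Ico.1 hs).1)
  simp only [Finset.sum_const, Nat.card_Ico, nsmul_eq_mul, mul_one, Nat.cast_sub ht,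
    Nat.cast_one] at this
  simp only [designMatrix, trace_add, trace_one, trace_sum, trace_vecMulVec, Fintype.card_fin]
  nlinarith

lemma half_le_log_one_add {q : ℝ} (h0 : 0 ≤ q) (h1 : q ≤ 1) : q / 2 ≤ Real.log (1 + q) := by
  have h := Real.one_sub_inv_le_log_of_pos (show 0 < 1 + q by linarith)
  refine le_trans ?_ h
  rw [inv_eq_one_div, le_sub_iff_add_le, ← le_sub_iff_add_le', div_le_iff₀ (by linarith)]
  nlinarith

/-- The elliptical potential lemma. -/
lemma sum_invNormSq_le (hd : 1 ≤ d) (hx : ∀ s, 1 ≤ s → ‖x s‖ ≤ 1) (t : ℕ) :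
    ∑ s ∈ Finset.Icc 1 t, invNormSq x s (x s) ≤ 2 * (d * Real.log (t + 1)) := by
  -- Each term q ≤ 1 satisfies q ≤ 2 log(1 + q), and 1 + q is exactly the growth factor of the
  -- determinant; round `t` enters det V_{t+1}, whence log(t + 1).
  have key : ∀ t : ℕ, ∑ s ∈ Finset.Icc 1 t, invNormSq x s (x s) ≤
      2 * Real.log (designMatrix x (t + 1)).det := by
    intro t
    induction t with
    | zero => simp [designMatrix_one]
    | succ t ih =>
      have h0 := invNormSq_nonneg x (t + 1) (x (t + 1))
      have h1 : invNormSq x (t + 1) (x (t + 1)) ≤ 1 :=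
        (invNormSq_le_norm_sq x (by omega) _).trans
          (pow_le_one₀ (norm_nonneg _) (hx _ (by omega)))
      rw [Finset.sum_Icc_succ_top (by omega), det_designMatrix_succ x (by omega),
        Real.log_mul (posDef_designMatrix x _).det_pos.ne' (by linarith)]
      have := half_le_log_one_add h0 h1
      linarith
  refine (key t).trans ?_
  have := log_det_designMatrix_le hd hx (t := t + 1) (by omega)
  push_cast at this
  linarith

lemma sum_sqrt_invNormSq_le (hd : 1 ≤ d) (hx : ∀ s, 1 ≤ s → ‖x s‖ ≤ 1) (t : ℕ) :
    ∑ s ∈ Finset.Icc 1 t, √(invNormSq x s (x s)) ≤ √(t * (2 * (d * Real.log (t + 1)))) := by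
  refine Real.le_sqrt_of_sq_le ?_
  have h := sq_sum_le_card_mul_sum_sq (s := Finset.Icc 1 t)
    (f := fun s => √(invNormSq x s (x s)))
  simp only [Nat.card_Icc, Nat.add_sub_cancel, Real.sq_sqrt (invNormSq_nonneg x _ _)] at h
  exact h.trans (mul_le_mul_of_nonneg_left (sum_invNormSq_le hd hx t) (by positivity))

end Design

/-! ### The self-normalised sum -/

section SelfNormalised

variable {d : ℕ} (x : ℕ → EuclideanSpace ℝ (Fin d)) (ζ : ℕ → ℝ)

/-- The noise sum `W_t = ∑_{s < t} ζ_s x_s`. -/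
def noiseSum (t : ℕ) : Fin d → ℝ := ∑ s ∈ Finset.Ico 1 t, ζ s • (x s).ofLp

/-- The self-normalised square `‖W_t‖²_{V_t⁻¹}`. -/
noncomputable def selfNormSq (t : ℕ) : ℝ := noiseSum x ζ t ⬝ᵥ (designMatrix x t)⁻¹ *ᵥ noiseSum x ζ t

lemma noiseSum_one : noiseSum x ζ 1 = 0 := by simp [noiseSum]

lemma noiseSum_succ {t : ℕ} (ht : 1 ≤ t) :
    noiseSum x ζ (t + 1) = noiseSum x ζ t + ζ t • (x t).ofLp := by
  rw [noiseSum, Finset.sum_Ico_succ_top ht, noiseSum]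

/-- The predictable cross term `x_tᵀ V_t⁻¹ W_t`. -/
noncomputable def crossTerm (t : ℕ) : ℝ := (x t).ofLp ⬝ᵥ (designMatrix x t)⁻¹ *ᵥ noiseSum x ζ t

lemma selfNormSq_succ {t : ℕ} (ht : 1 ≤ t) :
    selfNormSq x ζ (t + 1) = selfNormSq x ζ t +
      (2 * ζ t * crossTerm x ζ t + ζ t ^ 2 * invNormSq x t (x t) - crossTerm x ζ t ^ 2) /
        (1 + invNormSq x t (x t)) := by
  have hq : 1 + invNormSq x t (x t) ≠ 0 := by
    have := invNormSq_nonneg x t (x t)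
    positivity
  have hV := posDef_designMatrix x t
  rw [selfNormSq, designMatrix_succ x ht, noiseSum_succ x ζ ht,
    dotProduct_mulVec_inv_add_vecMulVec hV]
  rw [invNormSq] at hq
  simp only [mulVec_add, mulVec_smul, add_dotProduct, dotProduct_add, smul_dotProduct,
    dotProduct_smul, smul_eq_mul, dotProduct_mulVec_inv_comm hV (noiseSum x ζ t) (x t).ofLp,
    selfNormSq, crossTerm, invNormSq]
  field_simp
  ring

/-- The mixture of exponential supermartingales, `exp (‖W_t‖²_{V_t⁻¹} / 2) / √(det V_t)`. -/
noncomputable def mixtureWeight (t : ℕ) : ℝ :=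
  Real.exp (selfNormSq x ζ t / 2) / √(designMatrix x t).det

lemma mixtureWeight_one : mixtureWeight x ζ 1 = 1 := by
  simp [mixtureWeight, selfNormSq, noiseSum_one, designMatrix_one]

lemma mixtureWeight_pos (t : ℕ) : 0 < mixtureWeight x ζ t :=
  div_pos (Real.exp_pos _) (Real.sqrt_pos.2 (posDef_designMatrix x t).det_pos)

/-- The growth factor is the integral of exp(lζ - l²/2) over l ~ N(c, q), with c the cross term and
q the squared width of x_t (`lintegral_gaussian_mixture`). Thus a one-dimensional Gaussian mixture
per round suffices for the supermartingale property. -/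
lemma mixtureWeight_succ {t : ℕ} (ht : 1 ≤ t) :
    mixtureWeight x ζ (t + 1) = mixtureWeight x ζ t *
      (Real.exp ((2 * ζ t * crossTerm x ζ t + ζ t ^ 2 * invNormSq x t (x t)
        - crossTerm x ζ t ^ 2) / (2 * (1 + invNormSq x t (x t)))) /
        √(1 + invNormSq x t (x t))) := by
  rw [mixtureWeight, det_designMatrix_succ x ht, Real.sqrt_mul (posDef_designMatrix x t).det_pos.le,
    selfNormSq_succ x ζ ht, add_div, Real.exp_add, mixtureWeight, div_div, mul_comm (2 : ℝ) (1 + _)]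
  ring

lemma selfNormSq_le_of_mixtureWeight_le {t : ℕ} {c : ℝ} (h : mixtureWeight x ζ t ≤ c) :
    selfNormSq x ζ t ≤ 2 * Real.log c + Real.log (designMatrix x t).det := by
  have hdet := (posDef_designMatrix x t).det_pos
  have h2 := Real.log_le_log (mixtureWeight_pos x ζ t) h
  rw [mixtureWeight, Real.log_div (Real.exp_pos _).ne' (Real.sqrt_pos.2 hdet).ne', Real.log_exp,
    Real.log_sqrt hdet.le] at h2
  linarith

end SelfNormalised

/-! ### Confidence widths and optimism, along one trajectory -/

section Trajectory

variable {m d : ℕ} {𝒳 : Set (EuclideanSpace ℝ (Fin d))} {A : Matrix (Fin m) (Fin d) ℝ}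
  {x : ℕ → EuclideanSpace ℝ (Fin d)} {i : ℕ → Fin m} {S : ℕ → EuclideanSpace ℝ (Fin m)}

/-- The noise of the `k`-th coordinate along one trajectory. -/
noncomputable def coordNoise (A : Matrix (Fin m) (Fin d) ℝ) (x : ℕ → EuclideanSpace ℝ (Fin d))
    (S : ℕ → EuclideanSpace ℝ (Fin m)) (k : Fin m) (s : ℕ) : ℝ :=
  S s k - meanScore A (x s) k

lemma meanScore_apply (A : Matrix (Fin m) (Fin d) ℝ) (y : EuclideanSpace ℝ (Fin d)) (k : Fin m) :
    meanScore A y k = A k ⬝ᵥ y.ofLp := rfl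

/-- Splits the estimation error into the noise part W_tᵀV_t⁻¹y and the bias -A^kV_t⁻¹y caused by the
regulariser. -/
lemma meanScore_rlsEstimate (A : Matrix (Fin m) (Fin d) ℝ) (x : ℕ → EuclideanSpace ℝ (Fin d))
    (S : ℕ → EuclideanSpace ℝ (Fin m)) (t : ℕ) (y : EuclideanSpace ℝ (Fin d)) (k : Fin m) :
    meanScore (rlsEstimate x S t) y k = meanScore A y k +
      (noiseSum x (coordNoise A x S k) t ⬝ᵥ (designMatrix x t)⁻¹ *ᵥ y.ofLp -
        A k ⬝ᵥ (designMatrix x t)⁻¹ *ᵥ y.ofLp) := by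
  set v := (designMatrix x t)⁻¹ *ᵥ y.ofLp with hv
  have hVv : designMatrix x t *ᵥ v = y.ofLp := by
    rw [hv, mulVec_mulVec, mul_nonsing_inv _ (posDef_designMatrix x t).det_pos.ne'.isUnit,
      one_mulVec]
  have h1 : meanScore (rlsEstimate x S t) y k =
      ∑ s ∈ Finset.Ico 1 t, S s k * ((x s).ofLp ⬝ᵥ v) := by
    rw [meanScore, rlsEstimate, ← mulVec_mulVec, ← hv]
    simp [Matrix.sum_mulVec, vecMulVec_mulVec, mul_comm]
  have h2 : meanScore A y k = A k ⬝ᵥ v +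
      ∑ s ∈ Finset.Ico 1 t, meanScore A (x s) k * ((x s).ofLp ⬝ᵥ v) := by
    rw [meanScore_apply, ← hVv, designMatrix, add_mulVec, one_mulVec, Matrix.sum_mulVec,
      dotProduct_add, dotProduct_sum]
    simp [vecMulVec_mulVec, meanScore_apply, mul_comm]
  have h3 : noiseSum x (coordNoise A x S k) t ⬝ᵥ v =
      ∑ s ∈ Finset.Ico 1 t, (S s k - meanScore A (x s) k) * ((x s).ofLp ⬝ᵥ v) := by
    simp [noiseSum, sum_dotProduct, coordNoise]
  rw [h1, h2, h3]
  simp only [sub_mul, Finset.sum_sub_distrib]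
  ring

/-- Cauchy-Schwarz in V_t⁻¹ for both parts of the error; the summand 1 is the bias, since rows have
norm at most one and V_t ≥ I. -/
lemma abs_meanScore_rlsEstimate_sub_le {t : ℕ} (ht : 1 ≤ t) {k : Fin m} {b : ℝ}
    (hA : ‖(WithLp.toLp 2 (A k) : EuclideanSpace ℝ (Fin d))‖ ≤ 1)
    (hb : selfNormSq x (coordNoise A x S k) t ≤ b) (y : EuclideanSpace ℝ (Fin d)) :
    |meanScore (rlsEstimate x S t) y k - meanScore A y k| ≤
      (1 + √b) * √(invNormSq x t y) := by
  have hV := posDef_designMatrix x t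
  rw [meanScore_rlsEstimate A, add_sub_cancel_left]
  have h1 := abs_dotProduct_mulVec_inv_le hV (noiseSum x (coordNoise A x S k) t) y.ofLp
  have h2 := abs_dotProduct_mulVec_inv_le hV (A k) y.ofLp
  have h3 : √(A k ⬝ᵥ (designMatrix x t)⁻¹ *ᵥ A k) ≤ 1 := by
    have := invNormSq_le_norm_sq x ht (WithLp.toLp 2 (A k))
    exact Real.sqrt_le_one.2 (this.trans (pow_le_one₀ (norm_nonneg _) hA))
  have h4 := Real.sqrt_le_sqrt hb
  have h5 := Real.sqrt_nonneg (y.ofLp ⬝ᵥ (designMatrix x t)⁻¹ *ᵥ y.ofLp)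
  rw [selfNormSq] at h4
  rw [invNormSq]
  calc _ ≤ _ := abs_sub _ _
    _ ≤ _ := add_le_add h1 h2
    _ ≤ √b * √(y.ofLp ⬝ᵥ (designMatrix x t)⁻¹ *ᵥ y.ofLp) +
        1 * √(y.ofLp ⬝ᵥ (designMatrix x t)⁻¹ *ᵥ y.ofLp) := by gcongr
    _ = _ := by ring

lemma minScore_le (B : Matrix (Fin m) (Fin d) ℝ) (y : EuclideanSpace ℝ (Fin d)) (k : Fin m) :
    minScore B y ≤ meanScore B y k :=
  ciInf_le (Set.finite_range _).bddBelow k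

lemma abs_meanScore_le (hbdd : BoundedInstance 𝒳 A) {y : EuclideanSpace ℝ (Fin d)} (hy : y ∈ 𝒳)
    (k : Fin m) : |meanScore A y k| ≤ 1 := by
  have h := abs_real_inner_le_norm y (WithLp.toLp 2 (A k))
  have h' : inner ℝ y (WithLp.toLp 2 (A k)) = meanScore A y k := by
    rw [meanScore_apply, EuclideanSpace.inner_eq_star_dotProduct]
    simp
  rw [h'] at h
  exact h.trans (mul_le_one₀ (hbdd.action_norm_le y hy) (norm_nonneg _) (hbdd.row_norm_le k))

lemma minScore_le_signalLevel (hbdd : BoundedInstance 𝒳 A) (k : Fin m)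
    {y : EuclideanSpace ℝ (Fin d)} (hy : y ∈ 𝒳) : minScore A y ≤ signalLevel 𝒳 A := by
  refine le_csSup ⟨1, ?_⟩ ⟨y, hy, rfl⟩
  rintro _ ⟨z, hz, rfl⟩
  exact (minScore_le A z k).trans (abs_le.1 (abs_meanScore_le hbdd hz k)).2

lemma abs_signalLevel_le (hbdd : BoundedInstance 𝒳 A) (k : Fin m)
    {y : EuclideanSpace ℝ (Fin d)} (hy : y ∈ 𝒳) : |signalLevel 𝒳 A| ≤ 1 := by
  have : Nonempty (Fin m) := ⟨k⟩
  refine abs_le.2 ⟨?_, ?_⟩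
  · refine le_trans ?_ (minScore_le_signalLevel hbdd k hy)
    exact le_ciInf fun j => (abs_le.1 (abs_meanScore_le hbdd hy j)).1
  · refine csSup_le ⟨_, y, hy, rfl⟩ ?_
    rintro _ ⟨z, hz, rfl⟩
    exact (minScore_le A z k).trans (abs_le.1 (abs_meanScore_le hbdd hz k)).2

lemma minScore_sub_le {B C : Matrix (Fin m) (Fin d) ℝ} {y : EuclideanSpace ℝ (Fin d)} {r : ℝ}
    (k : Fin m) (h : ∀ k, |meanScore B y k - meanScore C y k| ≤ r) :
    minScore C y - r ≤ minScore B y := by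
  have : Nonempty (Fin m) := ⟨k⟩
  refine le_ciInf fun j => ?_
  have h1 := (abs_le.1 (h j)).1
  have h2 := minScore_le C y j
  linarith

/-- The tempered radius dominates any linear confidence width up to a term independent of the
action. -/
lemma mul_sqrt_le_rad_add (hd : 1 ≤ d) {t : ℕ} (ht : 1 ≤ t) (b : ℝ)
    (x : ℕ → EuclideanSpace ℝ (Fin d)) (y : EuclideanSpace ℝ (Fin d)) :
    b * √(invNormSq x t y) ≤ rad x t y + b ^ 2 * √d / 4 * (1 / √t) := by
  have hq := invNormSq_nonneg x t y
  have hd' : (0 : ℝ) < √d := Real.sqrt_pos.2 (by exact_mod_cast hd)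
  have ht' : (0 : ℝ) < √t := Real.sqrt_pos.2 (by exact_mod_cast ht)
  rw [rad, Real.sqrt_div (by positivity)]
  have hr : 0 ≤ √((d : ℝ) * invNormSq x t y) := Real.sqrt_nonneg _
  generalize √((d : ℝ) * invNormSq x t y) = r at *
  have hs := Real.sq_sqrt hq
  generalize √(invNormSq x t y) = u at *
  rw [← hs]
  -- Only the quadratic part of the radius is needed here; its linear part is just nonnegative.
  have key : 0 ≤ (√t * u * 2 - b * √d) ^ 2 / (4 * √d * √t) := by positivity
  have : (√t * u * 2 - b * √d) ^ 2 / (4 * √d * √t) =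
      √t / √d * u ^ 2 + b ^ 2 * √d / 4 * (1 / √t) - b * u := by
    field_simp
    ring
  linarith

lemma sum_one_div_sqrt_le (t : ℕ) : ∑ s ∈ Finset.Icc 1 t, 1 / √(s : ℝ) ≤ 2 * √t := by
  induction t with
  | zero => simp
  | succ t ih =>
    rw [Finset.sum_Icc_succ_top (by omega)]
    have h1 : (0 : ℝ) < √((t + 1 : ℕ) : ℝ) := Real.sqrt_pos.2 (by positivity)
    have h2 : √((t + 1 : ℕ) : ℝ) ^ 2 = t + 1 := by
      rw [Real.sq_sqrt (by positivity)]
      push_cast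
      rfl
    have h3 : √(t : ℝ) ^ 2 = t := Real.sq_sqrt (by positivity)
    -- Makes the sum telescope; it amounts to (√(t+1) - √t)² ≥ 0.
    have h4 : 1 / √((t + 1 : ℕ) : ℝ) ≤ 2 * (√((t + 1 : ℕ) : ℝ) - √(t : ℝ)) := by
      rw [div_le_iff₀ h1]
      nlinarith [sq_nonneg (√((t + 1 : ℕ) : ℝ) - √(t : ℝ))]
    linarith

section Rounds

variable {t : ℕ} {b : ℝ}

/-- Approximate optimism: for every y ∈ 𝒳 the true minimum is at most the index value of y plus the
action-free error, and x_t maximises the index. The last width passes from the estimated to the true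
score at x_t. -/
lemma signalLevel_sub_le (hd : 1 ≤ d) (hsel : TemperedSelection 𝒳 x i S) (ht : 1 ≤ t)
    (hconf : ∀ k y, |meanScore (rlsEstimate x S t) y k - meanScore A y k| ≤
      b * √(invNormSq x t y)) :
    signalLevel 𝒳 A - meanScore A (x t) (i t) ≤
      rad x t (x t) + b ^ 2 * √d / 4 * (1 / √t) + b * √(invNormSq x t (x t)) := by
  obtain ⟨hx, hmax, -⟩ := hsel t ht
  have h1 : signalLevel 𝒳 A ≤ minScore (rlsEstimate x S t) (x t) + rad x t (x t) +
      b ^ 2 * √d / 4 * (1 / √t) := by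
    refine csSup_le ⟨_, x t, hx, rfl⟩ ?_
    rintro _ ⟨y, hy, rfl⟩
    have h1 := minScore_sub_le (i t) fun k => hconf k y
    have h2 := mul_sqrt_le_rad_add hd ht b x y
    have h3 := hmax y hy
    linarith
  have h2 := minScore_le (rlsEstimate x S t) (x t) (i t)
  have h3 := (abs_le.1 (hconf (i t) (x t))).2
  linarith

/-- Only the choice of i_t matters: one width moves from the true to the estimated score of i_t, a
second from the estimated minimum back to the true minimum, which is at most Γ. -/
lemma meanScore_sub_signalLevel_le (hbdd : BoundedInstance 𝒳 A)
    (hsel : TemperedSelection 𝒳 x i S) (ht : 1 ≤ t)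
    (hconf : ∀ k y, |meanScore (rlsEstimate x S t) y k - meanScore A y k| ≤
      b * √(invNormSq x t y)) :
    meanScore A (x t) (i t) - signalLevel 𝒳 A ≤ 2 * b * √(invNormSq x t (x t)) := by
  obtain ⟨hx, -, hmin⟩ := hsel t ht
  have : Nonempty (Fin m) := ⟨i t⟩
  have h1 : meanScore (rlsEstimate x S t) (x t) (i t) ≤ minScore (rlsEstimate x S t) (x t) :=
    le_ciInf hmin
  have h2 := minScore_sub_le (i t) (B := A) (C := rlsEstimate x S t) (y := x t) fun k => by
    rw [abs_sub_comm]
    exact hconf k (x t)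
  have h3 := (abs_le.1 (hconf (i t) (x t))).1
  have h4 := minScore_le_signalLevel hbdd (i t) hx
  linarith

lemma TemperedSelection.norm_le (hbdd : BoundedInstance 𝒳 A) (hsel : TemperedSelection 𝒳 x i S) :
    ∀ s, 1 ≤ s → ‖x s‖ ≤ 1 :=
  fun s hs => hbdd.action_norm_le _ (hsel s hs).1

/-- The weights √(s/d) are replaced by the largest, √(t/d); then the elliptical potential bounds the
quadratic part and its Cauchy-Schwarz form the linear part. -/
lemma sum_rad_le (hd : 1 ≤ d) (hx : ∀ s, 1 ≤ s → ‖x s‖ ≤ 1) (t : ℕ) :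
    ∑ s ∈ Finset.Icc 1 t, rad x s (x s) ≤
      √((d : ℝ) * t) * (2 * Real.log (t + 1) + √d * √(2 * Real.log (t + 1))) := by
  have hd' : (0 : ℝ) < d := by exact_mod_cast hd
  have hl : 0 ≤ Real.log ((t : ℝ) + 1) := Real.log_nonneg (by linarith [Nat.cast_nonneg (α := ℝ) t])
  have hdd : √(d : ℝ) ^ 2 = d := Real.sq_sqrt hd'.le
  calc ∑ s ∈ Finset.Icc 1 t, rad x s (x s)
      ≤ ∑ s ∈ Finset.Icc 1 t, (√((t : ℝ) / d) * invNormSq x s (x s) +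
          √d * √(invNormSq x s (x s))) := by
        refine Finset.sum_le_sum fun s hs => ?_
        have hst : (s : ℝ) ≤ t := by exact_mod_cast (Finset.mem_Icc.1 hs).2
        have := invNormSq_nonneg x s (x s)
        rw [rad, Real.sqrt_mul hd'.le]
        gcongr
    _ ≤ √((t : ℝ) / d) * (2 * (d * Real.log (t + 1))) +
          √d * √(t * (2 * (d * Real.log (t + 1)))) := by
        rw [Finset.sum_add_distrib, ← Finset.mul_sum, ← Finset.mul_sum]
        gcongr
        · exact sum_invNormSq_le hd hx t
        · exact sum_sqrt_invNormSq_le hd hx t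
    _ = _ := by
        rw [show (t : ℝ) * (2 * (d * Real.log (t + 1))) = (d * t) * (2 * Real.log (t + 1)) by ring,
          Real.sqrt_mul (by positivity) (2 * Real.log (t + 1)), Real.sqrt_mul hd'.le,
          Real.sqrt_div (by positivity)]
        have e : √(t : ℝ) / √d * (2 * (d * Real.log (t + 1))) =
            √d * √t * (2 * Real.log (t + 1)) := by
          rw [div_mul_eq_mul_div, div_eq_iff (Real.sqrt_pos.2 hd').ne']
          linear_combination -(2 * √(t : ℝ) * Real.log (t + 1)) * hdd
        rw [e]
        ring

lemma sum_signalLevel_sub_le (hd : 1 ≤ d) (hbdd : BoundedInstance 𝒳 A)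
    (hsel : TemperedSelection 𝒳 x i S) (hb : 0 ≤ b)
    (hconf : ∀ s, 1 ≤ s → s ≤ t → ∀ k y,
      |meanScore (rlsEstimate x S s) y k - meanScore A y k| ≤ b * √(invNormSq x s y)) :
    ∑ s ∈ Finset.Icc 1 t, (signalLevel 𝒳 A - meanScore A (x s) (i s)) ≤
      √((d : ℝ) * t) * (2 * Real.log (t + 1) + √d * √(2 * Real.log (t + 1)) + b ^ 2 / 2 +
        b * √(2 * Real.log (t + 1))) := by
  have hx := hsel.norm_le hbdd
  have h1 := sum_rad_le hd hx t
  have h2 := mul_le_mul_of_nonneg_left (sum_sqrt_invNormSq_le hd hx t) hb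
  have h3 := mul_le_mul_of_nonneg_left (sum_one_div_sqrt_le t)
    (show 0 ≤ b ^ 2 * √(d : ℝ) / 4 by positivity)
  rw [show (t : ℝ) * (2 * (d * Real.log (t + 1))) = (d * t) * (2 * Real.log (t + 1)) by ring,
    Real.sqrt_mul (by positivity) (2 * Real.log (t + 1))] at h2
  have h4 : √((d : ℝ) * t) = √d * √t := Real.sqrt_mul (by positivity) _
  calc _ ≤ ∑ s ∈ Finset.Icc 1 t, (rad x s (x s) + b ^ 2 * √d / 4 * (1 / √s) +
          b * √(invNormSq x s (x s))) := by
        refine Finset.sum_le_sum fun s hs => ?_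
        rw [Finset.mem_Icc] at hs
        exact signalLevel_sub_le hd hsel hs.1 (hconf s hs.1 hs.2)
    _ ≤ _ := by
        rw [Finset.sum_add_distrib, Finset.sum_add_distrib, ← Finset.mul_sum, ← Finset.mul_sum]
        rw [h4] at h1 h2 ⊢
        linarith

lemma sum_meanScore_sub_signalLevel_le (hd : 1 ≤ d) (hbdd : BoundedInstance 𝒳 A)
    (hsel : TemperedSelection 𝒳 x i S) (hb : 0 ≤ b)
    (hconf : ∀ s, 1 ≤ s → s ≤ t → ∀ k y,
      |meanScore (rlsEstimate x S s) y k - meanScore A y k| ≤ b * √(invNormSq x s y)) :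
    ∑ s ∈ Finset.Icc 1 t, (meanScore A (x s) (i s) - signalLevel 𝒳 A) ≤
      √((d : ℝ) * t) * (2 * b * √(2 * Real.log (t + 1))) := by
  have hx := hsel.norm_le hbdd
  have h2 := mul_le_mul_of_nonneg_left (sum_sqrt_invNormSq_le hd hx t)
    (show 0 ≤ 2 * b by positivity)
  rw [show (t : ℝ) * (2 * (d * Real.log (t + 1))) = (d * t) * (2 * Real.log (t + 1)) by ring,
    Real.sqrt_mul (by positivity) (2 * Real.log (t + 1))] at h2
  calc _ ≤ ∑ s ∈ Finset.Icc 1 t, 2 * b * √(invNormSq x s (x s)) := by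
        refine Finset.sum_le_sum fun s hs => ?_
        rw [Finset.mem_Icc] at hs
        exact meanScore_sub_signalLevel_le hbdd hsel hs.1 (hconf s hs.1 hs.2)
    _ ≤ _ := by
        rw [← Finset.mul_sum]
        linarith

end Rounds

/-- The confidence event at level `ℓ` along one trajectory. -/
def Confident (A : Matrix (Fin m) (Fin d) ℝ) (x : ℕ → EuclideanSpace ℝ (Fin d))
    (S : ℕ → EuclideanSpace ℝ (Fin m)) (ℓ : ℝ) : Prop :=
  ∀ t, 1 ≤ t → ∀ k,
    selfNormSq x (coordNoise A x S k) t ≤ 2 * ℓ + Real.log (designMatrix x t).det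

variable {ℓ : ℝ}

lemma Confident.abs_sub_le (hd : 1 ≤ d) (hbdd : BoundedInstance 𝒳 A)
    (hsel : TemperedSelection 𝒳 x i S) (h : Confident A x S ℓ) {t : ℕ} :
    ∀ s, 1 ≤ s → s ≤ t → ∀ k y, |meanScore (rlsEstimate x S s) y k - meanScore A y k| ≤
      (1 + √(d * Real.log (t + 1) + 2 * ℓ)) * √(invNormSq x s y) := by
  intro s hs hst k y
  refine abs_meanScore_rlsEstimate_sub_le hs (hbdd.row_norm_le k) ((h s hs k).trans ?_) y
  have h1 := log_det_designMatrix_le hd (hsel.norm_le hbdd) hs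
  have h2 : Real.log s ≤ Real.log (t + 1) :=
    Real.log_le_log (by exact_mod_cast hs) (by exact_mod_cast hst.trans (Nat.le_succ t))
  have h3 := mul_le_mul_of_nonneg_left h2 (Nat.cast_nonneg (α := ℝ) d)
  linarith

lemma log_two_le_log_succ {t : ℕ} (ht : 1 ≤ t) : 0.69 ≤ Real.log ((t : ℝ) + 1) := by
  have h : (1 : ℝ) ≤ t := by exact_mod_cast ht
  have := Real.log_le_log (by norm_num) (show (2 : ℝ) ≤ t + 1 by linarith)
  linarith [Real.log_two_gt_d9]

lemma Confident.sum_signalLevel_sub_le (hd : 1 ≤ d) (hbdd : BoundedInstance 𝒳 A)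
    (hsel : TemperedSelection 𝒳 x i S) (h : Confident A x S ℓ) (hℓ : 2 ≤ ℓ) {t : ℕ} (ht : 1 ≤ t) :
    ∑ s ∈ Finset.Icc 1 t, (signalLevel 𝒳 A - meanScore A (x s) (i s)) ≤
      √((d : ℝ) * t) * (10 * (d * Real.log (t + 1)) + 4 * ℓ) := by
  refine (TemperedTest.sum_signalLevel_sub_le hd hbdd hsel (by positivity)
    (h.abs_sub_le hd hbdd hsel)).trans (mul_le_mul_of_nonneg_left ?_ (Real.sqrt_nonneg _))
  have hl := log_two_le_log_succ ht
  have hd' : (1 : ℝ) ≤ d := by exact_mod_cast hd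
  generalize Real.log ((t : ℝ) + 1) = l at *
  have hdl : l ≤ d * l := by nlinarith
  have hdl' : 0.69 * d ≤ d * l := by nlinarith
  have hu : √(2 * l) ^ 2 = 2 * l := Real.sq_sqrt (by linarith)
  have hD : √(d : ℝ) ^ 2 = d := Real.sq_sqrt (by linarith)
  have hc : √(d * l + 2 * ℓ) ^ 2 = d * l + 2 * ℓ := Real.sq_sqrt (by linarith)
  generalize √(2 * l) = u at *
  generalize √(d : ℝ) = D at *
  generalize √(d * l + 2 * ℓ) = c at *
  -- AM-GM on every product of roots leaves terms in d, d·l and ℓ; the bounds l ≥ 0.69 and ℓ ≥ 2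
  -- absorb the constants into 10·d·l + 4ℓ.
  nlinarith [sq_nonneg (D - u), sq_nonneg (c - u), sq_nonneg (c - 1), sq_nonneg (u - 1)]

lemma Confident.sum_meanScore_sub_signalLevel_le (hd : 1 ≤ d) (hbdd : BoundedInstance 𝒳 A)
    (hsel : TemperedSelection 𝒳 x i S) (h : Confident A x S ℓ) (t : ℕ) :
    ∑ s ∈ Finset.Icc 1 t, (meanScore A (x s) (i s) - signalLevel 𝒳 A) ≤
      √((d : ℝ) * t) * (2 * (1 + √(d * Real.log (t + 1) + 2 * ℓ)) * √(2 * Real.log (t + 1))) :=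
  TemperedTest.sum_meanScore_sub_signalLevel_le hd hbdd hsel (by positivity)
    (h.abs_sub_le hd hbdd hsel)

end Trajectory

/-! ### Conditionally sub-Gaussian variables with predictable multipliers -/

section CondSubGaussian

open ENNReal Filter Topology

variable {Ω : Type*} {ℱ : MeasurableSpace Ω} [mΩ : MeasurableSpace Ω] {μ : Measure Ω} {ζ : Ω → ℝ}

/-- `ζ` is `1`-subGaussian given the σ-algebra `ℱ`, tested against the events of `ℱ`. -/
def CondSubGaussian {Ω : Type*} (ℱ : MeasurableSpace Ω) [MeasurableSpace Ω] (μ : Measure Ω)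
    (ζ : Ω → ℝ) : Prop :=
  ∀ l : ℝ, ∀ B, MeasurableSet[ℱ] B →
    ∫⁻ ω in B, ENNReal.ofReal (Real.exp (l * ζ ω)) ∂μ ≤
      ENNReal.ofReal (Real.exp (l ^ 2 / 2)) * μ B

lemma CondSubGaussian.neg (h : CondSubGaussian ℱ μ ζ) : CondSubGaussian ℱ μ fun ω => -ζ ω := by
  intro l B hB
  simpa using h (-l) B hB

lemma CondSubGaussian.setLIntegral_exp_sub_le (h : CondSubGaussian ℱ μ ζ) (l : ℝ) {B : Set Ω}
    (hB : MeasurableSet[ℱ] B) :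
    ∫⁻ ω in B, ENNReal.ofReal (Real.exp (l * ζ ω - l ^ 2 / 2)) ∂μ ≤ μ B := by
  have h1 : ∀ ω, ENNReal.ofReal (Real.exp (l * ζ ω - l ^ 2 / 2)) =
      ENNReal.ofReal (Real.exp (-(l ^ 2 / 2))) * ENNReal.ofReal (Real.exp (l * ζ ω)) := fun ω => by
    rw [← ENNReal.ofReal_mul (Real.exp_pos _).le, ← Real.exp_add]
    ring_nf
  simp_rw [h1]
  rw [lintegral_const_mul' _ _ ENNReal.ofReal_ne_top]
  refine (mul_le_mul_right (h l B hB) _).trans ?_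
  rw [← mul_assoc, ← ENNReal.ofReal_mul (Real.exp_pos _).le, ← Real.exp_add]
  simp

/-- A countably valued predictable multiplier is constant on each piece of a partition of `B` into
events of `ℱ`. -/
lemma CondSubGaussian.setLIntegral_exp_le_of_countable (h : CondSubGaussian ℱ μ ζ) (hℱ : ℱ ≤ mΩ)
    {g : Ω → ℤ} (hg : Measurable[ℱ] g) (c : ℤ → ℝ) {B : Set Ω} (hB : MeasurableSet[ℱ] B) :
    ∫⁻ ω in B, ENNReal.ofReal (Real.exp (c (g ω) * ζ ω - c (g ω) ^ 2 / 2)) ∂μ ≤ μ B := by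
  have hm : ∀ j : ℤ, MeasurableSet[ℱ] (B ∩ g ⁻¹' {j}) := fun j =>
    hB.inter (hg (measurableSet_singleton j))
  have hU : B = ⋃ j : ℤ, B ∩ g ⁻¹' {j} := by
    ext ω
    simp
  have hdisj : Pairwise (Function.onFun Disjoint fun j : ℤ => B ∩ g ⁻¹' {j}) := by
    intro j k hjk
    refine Set.disjoint_left.2 fun ω h1 h2 => hjk ?_
    exact (Set.mem_singleton_iff.1 h1.2).symm.trans h2.2
  calc _ = ∑' j : ℤ, ∫⁻ ω in B ∩ g ⁻¹' {j},
        ENNReal.ofReal (Real.exp (c (g ω) * ζ ω - c (g ω) ^ 2 / 2)) ∂μ := by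
        conv_lhs => rw [hU]
        exact lintegral_iUnion (fun j => hℱ _ (hm j)) hdisj _
    _ = ∑' j : ℤ, ∫⁻ ω in B ∩ g ⁻¹' {j},
        ENNReal.ofReal (Real.exp (c j * ζ ω - c j ^ 2 / 2)) ∂μ := by
        refine tsum_congr fun j => setLIntegral_congr_fun (hℱ _ (hm j)) fun ω hω => ?_
        rw [Set.mem_singleton_iff.1 hω.2]
    _ ≤ ∑' j : ℤ, μ (B ∩ g ⁻¹' {j}) :=
        ENNReal.tsum_le_tsum fun j => h.setLIntegral_exp_sub_le (c j) (hm j)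
    _ = μ B := by
        conv_rhs => rw [hU]
        exact (measure_iUnion hdisj fun j => hℱ _ (hm j)).symm

/-- Splitting along the value of the predictable index reduces to a fixed coordinate; this makes the
noise of the selected constraint subGaussian. -/
lemma CondSubGaussian.eval {m : ℕ} (hℱ : ℱ ≤ mΩ) {f : Fin m → Ω → ℝ}
    (h : ∀ k, CondSubGaussian ℱ μ (f k)) {j : Ω → Fin m} (hj : Measurable[ℱ] j) :
    CondSubGaussian ℱ μ fun ω => f (j ω) ω := by
  intro l B hB
  have hm : ∀ k, MeasurableSet[ℱ] (B ∩ j ⁻¹' {k}) := fun k =>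
    hB.inter (hj (measurableSet_singleton k))
  have hU : B = ⋃ k, B ∩ j ⁻¹' {k} := by
    ext ω
    simp
  have hdisj : Pairwise (Function.onFun Disjoint fun k => B ∩ j ⁻¹' {k}) := by
    intro k k' hk
    refine Set.disjoint_left.2 fun ω h1 h2 => hk ?_
    exact (Set.mem_singleton_iff.1 h1.2).symm.trans h2.2
  calc _ = ∑' k, ∫⁻ ω in B ∩ j ⁻¹' {k}, ENNReal.ofReal (Real.exp (l * f (j ω) ω)) ∂μ := by
        conv_lhs => rw [hU]
        exact lintegral_iUnion (fun k => hℱ _ (hm k)) hdisj _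
    _ = ∑' k, ∫⁻ ω in B ∩ j ⁻¹' {k}, ENNReal.ofReal (Real.exp (l * f k ω)) ∂μ := by
        refine tsum_congr fun k => setLIntegral_congr_fun (hℱ _ (hm k)) fun ω hω => ?_
        rw [Set.mem_singleton_iff.1 hω.2]
    _ ≤ ∑' k, ENNReal.ofReal (Real.exp (l ^ 2 / 2)) * μ (B ∩ j ⁻¹' {k}) :=
        ENNReal.tsum_le_tsum fun k => h k l _ (hm k)
    _ = _ := by
        rw [ENNReal.tsum_mul_left]
        conv_rhs => rw [hU]
        rw [measure_iUnion hdisj fun k => hℱ _ (hm k)]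

lemma tendsto_floor_mul_div (a : ℝ) :
    Tendsto (fun n : ℕ => (⌊a * (n + 1)⌋ : ℝ) / (n + 1)) atTop (𝓝 a) := by
  have h0 : Tendsto (fun n : ℕ => a - 1 / ((n : ℝ) + 1)) atTop (𝓝 (a - 0)) :=
    tendsto_const_nhds.sub tendsto_one_div_add_atTop_nhds_zero_nat
  rw [sub_zero] at h0
  refine tendsto_of_tendsto_of_tendsto_of_le_of_le h0 tendsto_const_nhds (fun n => ?_) fun n => ?_
  · have hn : (0 : ℝ) < n + 1 := by positivity
    have := Int.lt_floor_add_one (a * ((n : ℝ) + 1))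
    simp only
    rw [le_div_iff₀ hn, sub_mul, one_div_mul_cancel hn.ne']
    linarith
  · have hn : (0 : ℝ) < n + 1 := by positivity
    exact (div_le_iff₀ hn).2 (Int.floor_le _)

/-- Round the multiplier down to the grid of mesh 1/(n+1), where the countable case applies, and
pass to the limit with Fatou's lemma. -/
lemma CondSubGaussian.setLIntegral_exp_le (h : CondSubGaussian ℱ μ ζ) (hℱ : ℱ ≤ mΩ)
    (hζ : Measurable ζ) {l : Ω → ℝ} (hl : Measurable[ℱ] l) {B : Set Ω} (hB : MeasurableSet[ℱ] B) :
    ∫⁻ ω in B, ENNReal.ofReal (Real.exp (l ω * ζ ω - l ω ^ 2 / 2)) ∂μ ≤ μ B := by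
  set L : ℕ → Ω → ℝ := fun n ω => (⌊l ω * (n + 1)⌋ : ℝ) / (n + 1) with hL
  have hgm : ∀ n : ℕ, Measurable[ℱ] fun ω => ⌊l ω * ((n : ℝ) + 1)⌋ := fun n =>
    Int.measurable_floor.comp (hl.mul_const _)
  have hLm : ∀ n, Measurable (L n) := fun n =>
    ((measurable_from_top (f := fun j : ℤ => (j : ℝ))).comp ((hgm n).mono hℱ le_rfl)).div_const _
  calc _ = ∫⁻ ω in B, liminf (fun n => ENNReal.ofReal (Real.exp (L n ω * ζ ω - L n ω ^ 2 / 2)))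
        atTop ∂μ := by
        refine lintegral_congr fun ω => (Tendsto.liminf_eq ?_).symm
        refine (ENNReal.continuous_ofReal.comp Real.continuous_exp).continuousAt.tendsto.comp ?_
        exact ((tendsto_floor_mul_div (l ω)).mul_const _).sub
          (((tendsto_floor_mul_div (l ω)).pow 2).div_const 2)
    _ ≤ liminf (fun n => ∫⁻ ω in B, ENNReal.ofReal (Real.exp (L n ω * ζ ω - L n ω ^ 2 / 2)) ∂μ)
        atTop := by
        refine lintegral_liminf_le fun n => ?_
        have := hLm n
        fun_prop
    _ ≤ μ B := by
        refine liminf_le_of_frequently_le' (Frequently.of_forall fun n => ?_)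
        exact h.setLIntegral_exp_le_of_countable hℱ (hgm n) (fun j => (j : ℝ) / (n + 1)) hB

/-- A predictable multiplier and a predictable weight. -/
lemma CondSubGaussian.lintegral_mul_exp_le (h : CondSubGaussian ℱ μ ζ) (hℱ : ℱ ≤ mΩ)
    (hζ : Measurable ζ) {l : Ω → ℝ} (hl : Measurable[ℱ] l) {D : Ω → ℝ≥0∞} (hD : Measurable[ℱ] D) :
    ∫⁻ ω, D ω * ENNReal.ofReal (Real.exp (l ω * ζ ω - l ω ^ 2 / 2)) ∂μ ≤ ∫⁻ ω, D ω ∂μ := by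
  have hl' := hl.mono hℱ le_rfl
  have hf : Measurable fun ω => ENNReal.ofReal (Real.exp (l ω * ζ ω - l ω ^ 2 / 2)) := by fun_prop
  -- Domination on all events of `ℱ` is an inequality of trimmed measures, hence of integrals of all
  -- nonnegative `ℱ`-measurable weights.
  have hle : (μ.withDensity fun ω => ENNReal.ofReal (Real.exp (l ω * ζ ω - l ω ^ 2 / 2))).trim hℱ ≤
      μ.trim hℱ := by
    refine Measure.le_iff.2 fun B hB => ?_
    rw [trim_measurableSet_eq hℱ hB, trim_measurableSet_eq hℱ hB, withDensity_apply _ (hℱ _ hB)]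
    exact h.setLIntegral_exp_le hℱ hζ hl hB
  calc _ = ∫⁻ ω, D ω ∂(μ.withDensity fun ω =>
        ENNReal.ofReal (Real.exp (l ω * ζ ω - l ω ^ 2 / 2))) := by
        rw [lintegral_withDensity_eq_lintegral_mul _ hf (hD.mono hℱ le_rfl)]
        simp [mul_comm]
    _ ≤ _ := by
        rw [← lintegral_trim hℱ hD, ← lintegral_trim hℱ hD]
        exact lintegral_mono' hle le_rfl

/-- The Gaussian mixture of exponential martingale increments, in closed form. -/
lemma lintegral_gaussian_mixture (ζ a : ℝ) {q : ℝ} (hq : 0 ≤ q) :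
    ∫⁻ z : ℝ, ENNReal.ofReal (ProbabilityTheory.gaussianPDFReal 0 1 z) *
        ENNReal.ofReal (Real.exp ((a + √q * z) * ζ - (a + √q * z) ^ 2 / 2)) =
      ENNReal.ofReal (Real.exp ((2 * ζ * a + ζ ^ 2 * q - a ^ 2) / (2 * (1 + q))) / √(1 + q)) := by
  have h1 : 0 < 1 + q := by linarith
  have hs : √q ^ 2 = q := Real.sq_sqrt hq
  have hv : (Real.toNNReal (1 / (1 + q)) : ℝ) = 1 / (1 + q) := Real.coe_toNNReal _ (by positivity)
  have hv0 : Real.toNNReal (1 / (1 + q)) ≠ 0 := by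
    rw [Ne, Real.toNNReal_eq_zero, not_le]
    positivity
  -- Completing the square in `z` gives a Gaussian density with mean √q(ζ - a)/(1 + q) and variance
  -- 1/(1 + q), times a factor free of `z`.
  have key : ∀ z, ENNReal.ofReal (ProbabilityTheory.gaussianPDFReal 0 1 z) *
      ENNReal.ofReal (Real.exp ((a + √q * z) * ζ - (a + √q * z) ^ 2 / 2)) =
      ENNReal.ofReal (Real.exp ((2 * ζ * a + ζ ^ 2 * q - a ^ 2) / (2 * (1 + q))) / √(1 + q)) *
      ENNReal.ofReal (ProbabilityTheory.gaussianPDFReal (√q * (ζ - a) / (1 + q))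
        (Real.toNNReal (1 / (1 + q))) z) := by
    intro z
    rw [← ENNReal.ofReal_mul (ProbabilityTheory.gaussianPDFReal_nonneg _ _ _),
      ← ENNReal.ofReal_mul (by positivity)]
    congr 1
    rw [ProbabilityTheory.gaussianPDFReal, ProbabilityTheory.gaussianPDFReal, hv]
    have hr : √(2 * Real.pi * (1 / (1 + q))) = √(2 * Real.pi) / √(1 + q) := by
      rw [mul_one_div, Real.sqrt_div (by positivity)]
    have hr1 : √(1 + q) ≠ 0 := (Real.sqrt_pos.2 h1).ne'
    have hexp : Real.exp (-(z - 0) ^ 2 / (2 * ((1 : NNReal) : ℝ))) *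
        Real.exp ((a + √q * z) * ζ - (a + √q * z) ^ 2 / 2) =
        Real.exp ((2 * ζ * a + ζ ^ 2 * q - a ^ 2) / (2 * (1 + q))) *
        Real.exp (-(z - √q * (ζ - a) / (1 + q)) ^ 2 / (2 * (1 / (1 + q)))) := by
      rw [← Real.exp_add, ← Real.exp_add]
      congr 1
      have hq2 : q = √q ^ 2 := hs.symm
      generalize √q = r at *
      subst hq2
      simp only [NNReal.coe_one]
      field_simp
      ring
    rw [hr, NNReal.coe_one, mul_one, inv_div]
    rw [NNReal.coe_one] at hexp
    rw [mul_assoc, hexp]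
    field_simp
  simp_rw [key]
  rw [lintegral_const_mul' _ _ ENNReal.ofReal_ne_top,
    ProbabilityTheory.lintegral_gaussianPDFReal_eq_one _ hv0, mul_one]

/-- By Tonelli the Gaussian variable `z` may be fixed first; then a + √q·z is a predictable
multiplier. -/
lemma CondSubGaussian.lintegral_mul_mixture_le [SFinite μ] (h : CondSubGaussian ℱ μ ζ)
    (hℱ : ℱ ≤ mΩ) (hζ : Measurable ζ) {a q : Ω → ℝ} (ha : Measurable[ℱ] a) (hq : Measurable[ℱ] q)
    (hq0 : ∀ ω, 0 ≤ q ω) {D : Ω → ℝ≥0∞} (hD : Measurable[ℱ] D) :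
    ∫⁻ ω, D ω * ENNReal.ofReal (Real.exp ((2 * ζ ω * a ω + ζ ω ^ 2 * q ω - a ω ^ 2) /
      (2 * (1 + q ω))) / √(1 + q ω)) ∂μ ≤ ∫⁻ ω, D ω ∂μ := by
  have ha' := ha.mono hℱ le_rfl
  have hq' := hq.mono hℱ le_rfl
  have hD' := hD.mono hℱ le_rfl
  have hG : Measurable (ProbabilityTheory.gaussianPDFReal 0 1) :=
    ProbabilityTheory.measurable_gaussianPDFReal 0 1
  calc _ = ∫⁻ ω, (∫⁻ z : ℝ, D ω * (ENNReal.ofReal (ProbabilityTheory.gaussianPDFReal 0 1 z) *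
        ENNReal.ofReal (Real.exp ((a ω + √(q ω) * z) * ζ ω - (a ω + √(q ω) * z) ^ 2 / 2)))) ∂μ := by
        refine lintegral_congr fun ω => ?_
        rw [← lintegral_gaussian_mixture (ζ ω) (a ω) (hq0 ω), lintegral_const_mul]
        fun_prop
    _ = ∫⁻ z : ℝ, ∫⁻ ω, D ω * (ENNReal.ofReal (ProbabilityTheory.gaussianPDFReal 0 1 z) *
        ENNReal.ofReal (Real.exp ((a ω + √(q ω) * z) * ζ ω - (a ω + √(q ω) * z) ^ 2 / 2))) ∂μ := by
        refine lintegral_lintegral_swap (Measurable.aemeasurable ?_)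
        simp only [Function.uncurry_def]
        fun_prop
    _ ≤ ∫⁻ z : ℝ, ENNReal.ofReal (ProbabilityTheory.gaussianPDFReal 0 1 z) * ∫⁻ ω, D ω ∂μ := by
        refine lintegral_mono fun z => ?_
        simp_rw [mul_left_comm (D _)]
        rw [lintegral_const_mul' _ _ ENNReal.ofReal_ne_top]
        exact mul_le_mul_right (h.lintegral_mul_exp_le hℱ hζ (ha.add (hq.sqrt.mul_const z)) hD) _
    _ = _ := by
        rw [lintegral_mul_const _ hG.ennreal_ofReal,
          ProbabilityTheory.lintegral_gaussianPDFReal_eq_one _ one_ne_zero, one_mul]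

end CondSubGaussian

/-! ### Ville's inequality -/

section Ville

open ENNReal

variable {Ω : Type*} [mΩ : MeasurableSpace Ω] {μ : Measure Ω} {𝒢 : Filtration ℕ mΩ}
  {M : ℕ → Ω → ℝ≥0∞}

/-- Ville's maximal inequality for nonnegative supermartingales started at time one. -/
lemma mul_measure_exists_ge_le (hM : ∀ t, 1 ≤ t → Measurable[𝒢 t] (M t))
    (hsuper : ∀ t, 1 ≤ t → ∀ B, MeasurableSet[𝒢 t] B →
      ∫⁻ ω in B, M (t + 1) ω ∂μ ≤ ∫⁻ ω in B, M t ω ∂μ) (c : ℝ≥0∞) :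
    c * μ {ω | ∃ t, 1 ≤ t ∧ c ≤ M t ω} ≤ ∫⁻ ω, M 1 ω ∂μ := by
  set B : ℕ → Set Ω := fun n => {ω | ∃ t, 1 ≤ t ∧ t ≤ n ∧ c ≤ M t ω} with hBdef
  have hsucc : ∀ n, B (n + 1) = B n ∪ {ω | c ≤ M (n + 1) ω} := by
    intro n
    ext ω
    simp only [hBdef, Set.mem_ofPred_eq, Set.mem_union]
    constructor
    · rintro ⟨t, h1, h2, h3⟩
      rcases Nat.lt_or_ge n t with h | h
      · obtain rfl : t = n + 1 := by omega
        exact Or.inr h3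
      · exact Or.inl ⟨t, h1, h, h3⟩
    · rintro (⟨t, h1, h2, h3⟩ | h)
      · exact ⟨t, h1, by omega, h3⟩
      · exact ⟨n + 1, by omega, le_rfl, h⟩
  have hset : ∀ n, MeasurableSet[𝒢 (n + 1)] {ω | c ≤ M (n + 1) ω} := fun n =>
    hM (n + 1) (by omega) measurableSet_Ici
  have hBm : ∀ n, MeasurableSet[𝒢 (n + 1)] (B n) := by
    intro n
    induction n with
    | zero =>
      have : B 0 = ∅ := by
        ext ω
        simp only [hBdef, Set.mem_ofPred_eq, Set.mem_empty_iff_false, iff_false]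
        rintro ⟨t, h1, h2, -⟩
        omega
      rw [this]
      exact @MeasurableSet.empty _ (𝒢 (0 + 1))
    | succ n ih =>
      rw [hsucc]
      exact 𝒢.mono (Nat.le_succ _) _ (ih.union (hset n))
  -- The process stopped on reaching level `c`: crossed paths are counted at `c`, the others still
  -- carry M_{n+1}.
  have key : ∀ n, c * μ (B n) + ∫⁻ ω in (B n)ᶜ, M (n + 1) ω ∂μ ≤ ∫⁻ ω, M 1 ω ∂μ := by
    intro n
    induction n with
    | zero =>
      have : B 0 = ∅ := by
        ext ω
        simp only [hBdef, Set.mem_ofPred_eq, Set.mem_empty_iff_false, iff_false]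
        rintro ⟨t, h1, h2, -⟩
        omega
      simp [this]
    | succ n ih =>
      refine le_trans ?_ ih
      have hE := 𝒢.le (n + 1) _ (hset n)
      have hsplit := lintegral_inter_add_sdiff (μ := μ) (M (n + 1)) (B n)ᶜ hE
      have hc : (B (n + 1))ᶜ = (B n)ᶜ \ {ω | c ≤ M (n + 1) ω} := by
        rw [hsucc, Set.compl_union]
        rfl
      have h1 : c * μ ((B n)ᶜ ∩ {ω | c ≤ M (n + 1) ω}) ≤
          ∫⁻ ω in (B n)ᶜ ∩ {ω | c ≤ M (n + 1) ω}, M (n + 1) ω ∂μ := by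
        rw [← setLIntegral_const]
        exact setLIntegral_mono' ((𝒢.le _ _ (hBm n)).compl.inter hE) fun ω hω => hω.2
      -- `B (n + 1)` is known already at time n + 1, one step earlier than `hBm (n + 1)` records.
      have h2 := hsuper (n + 1) (by omega) (B (n + 1))ᶜ
        (by rw [hsucc]; exact ((hBm n).union (hset n)).compl)
      have h3 : μ (B (n + 1)) ≤ μ (B n) + μ ((B n)ᶜ ∩ {ω | c ≤ M (n + 1) ω}) := by
        refine (measure_mono ?_).trans (measure_union_le _ _)
        rw [hsucc]
        intro ω hω
        by_cases hb : ω ∈ B n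
        · exact Or.inl hb
        · exact Or.inr ⟨hb, hω.resolve_left hb⟩
      calc c * μ (B (n + 1)) + ∫⁻ ω in (B (n + 1))ᶜ, M (n + 1 + 1) ω ∂μ
          ≤ c * (μ (B n) + μ ((B n)ᶜ ∩ {ω | c ≤ M (n + 1) ω})) +
            ∫⁻ ω in (B (n + 1))ᶜ, M (n + 1) ω ∂μ := by gcongr
        _ ≤ c * μ (B n) + (∫⁻ ω in (B n)ᶜ ∩ {ω | c ≤ M (n + 1) ω}, M (n + 1) ω ∂μ +
            ∫⁻ ω in (B (n + 1))ᶜ, M (n + 1) ω ∂μ) := by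
            rw [mul_add, add_assoc]
            gcongr
        _ = _ := by rw [hc, hsplit]
  have hU : {ω | ∃ t, 1 ≤ t ∧ c ≤ M t ω} = ⋃ n, B n := by
    ext ω
    simp only [hBdef, Set.mem_ofPred_eq, Set.mem_iUnion]
    exact ⟨fun ⟨t, h1, h2⟩ => ⟨t, t, h1, le_rfl, h2⟩, fun ⟨_, t, h1, _, h2⟩ => ⟨t, h1, h2⟩⟩
  have hmono : Monotone B := monotone_nat_of_le_succ fun n => by
    rw [hsucc]
    exact Set.subset_union_left
  rw [hU, hmono.measure_iUnion, ENNReal.mul_iSup]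
  exact iSup_le fun n => le_self_add.trans (key n)

end Ville

/-! ### Measurability -/

section Measurability

variable {Ω : Type*} [MeasurableSpace Ω] {d : ℕ} {x : ℕ → Ω → EuclideanSpace ℝ (Fin d)}
  {ζ : ℕ → Ω → ℝ}

lemma measurable_coord {n : ℕ} {y : Ω → EuclideanSpace ℝ (Fin n)} (hy : Measurable y) (j : Fin n) :
    Measurable fun ω => y ω j := by
  have : Continuous fun z : EuclideanSpace ℝ (Fin n) => z j := by fun_prop
  exact this.measurable.comp hy

lemma measurable_eval {ι : Type*} [Fintype ι] [MeasurableSpace ι] [MeasurableSingletonClass ι]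
    {f : ι → Ω → ℝ} (hf : ∀ k, Measurable (f k)) {j : Ω → ι} (hj : Measurable j) :
    Measurable fun ω => f (j ω) ω := by
  classical
  have : (fun ω => f (j ω) ω) = fun ω => ∑ k, if j ω = k then f k ω else 0 := by
    ext ω
    simp
  rw [this]
  exact Finset.measurable_sum _ fun k _ =>
    Measurable.ite (hj (measurableSet_singleton k)) (hf k) measurable_const

lemma measurable_meanScore_apply {m : ℕ} (A : Matrix (Fin m) (Fin d) ℝ)
    {y : Ω → EuclideanSpace ℝ (Fin d)} (hy : Measurable y) (k : Fin m) :
    Measurable fun ω => meanScore A (y ω) k := by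
  simp only [meanScore_apply, dotProduct]
  exact Finset.measurable_sum _ fun j _ => (measurable_coord hy j).const_mul _

lemma measurable_noiseSum {t : ℕ} (hx : ∀ s, 1 ≤ s → s < t → Measurable (x s))
    (hζ : ∀ s, 1 ≤ s → s < t → Measurable (ζ s)) (j : Fin d) :
    Measurable fun ω => noiseSum (fun s => x s ω) (fun s => ζ s ω) t j := by
  simp only [noiseSum, Finset.sum_apply, Pi.smul_apply, smul_eq_mul]
  refine Finset.measurable_sum _ fun s hs => ?_
  rw [Finset.mem_Ico] at hs
  exact (hζ s hs.1 hs.2).mul (measurable_coord (hx s hs.1 hs.2) j)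

lemma measurable_dotProduct_mulVec {B : Ω → Matrix (Fin d) (Fin d) ℝ}
    (hB : ∀ i j, Measurable fun ω => B ω i j) {y z : Ω → Fin d → ℝ}
    (hy : ∀ j, Measurable fun ω => y ω j) (hz : ∀ j, Measurable fun ω => z ω j) :
    Measurable fun ω => y ω ⬝ᵥ B ω *ᵥ z ω := by
  simp only [dotProduct, mulVec]
  exact Finset.measurable_sum _ fun i _ => (hy i).mul
    (Finset.measurable_sum _ fun j _ => (hB i j).mul (hz j))

/-- Sherman-Morrison writes each entry of the new inverse as a rational expression in the old ones
and x_t, so measurability follows by induction. -/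
lemma measurable_designMatrix_inv {t : ℕ} (ht : 1 ≤ t)
    (hx : ∀ s, 1 ≤ s → s < t → Measurable (x s)) (i j : Fin d) :
    Measurable fun ω => (designMatrix (fun s => x s ω) t)⁻¹ i j := by
  induction t, ht using Nat.le_induction generalizing i j with
  | base => simp [designMatrix_one]
  | succ t ht ih =>
    have ih' := ih fun s h1 h2 => hx s h1 (by omega)
    have hxt := measurable_coord (hx t ht (by omega))
    have h : ∀ ω, (designMatrix (fun s => x s ω) (t + 1))⁻¹ i j =
        (Pi.single i 1 : Fin d → ℝ) ⬝ᵥ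
          (designMatrix (fun s => x s ω) t)⁻¹ *ᵥ (Pi.single j 1 : Fin d → ℝ) -
        ((Pi.single i 1 : Fin d → ℝ) ⬝ᵥ (designMatrix (fun s => x s ω) t)⁻¹ *ᵥ (x t ω).ofLp) *
        ((x t ω).ofLp ⬝ᵥ (designMatrix (fun s => x s ω) t)⁻¹ *ᵥ (Pi.single j 1 : Fin d → ℝ)) /
        (1 + (x t ω).ofLp ⬝ᵥ (designMatrix (fun s => x s ω) t)⁻¹ *ᵥ (x t ω).ofLp) := by
      intro ω
      rw [← dotProduct_mulVec_inv_add_vecMulVec (posDef_designMatrix _ t),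
        ← designMatrix_succ (fun s => x s ω) ht]
      simp
    simp_rw [h]
    have hc : ∀ k l : Fin d, Measurable fun _ : Ω => (Pi.single k 1 : Fin d → ℝ) l :=
      fun _ _ => measurable_const
    exact (measurable_dotProduct_mulVec ih' (hc i) (hc j)).sub
      (((measurable_dotProduct_mulVec ih' (hc i) hxt).mul
        (measurable_dotProduct_mulVec ih' hxt (hc j))).div
        ((measurable_dotProduct_mulVec ih' hxt hxt).const_add 1))

lemma measurable_invNormSq {t : ℕ} (ht : 1 ≤ t) (hx : ∀ s, 1 ≤ s → s ≤ t → Measurable (x s)) :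
    Measurable fun ω => invNormSq (fun s => x s ω) t (x t ω) :=
  measurable_dotProduct_mulVec (measurable_designMatrix_inv ht fun s h1 h2 => hx s h1 h2.le)
    (measurable_coord (hx t ht le_rfl)) (measurable_coord (hx t ht le_rfl))

lemma measurable_crossTerm {t : ℕ} (ht : 1 ≤ t) (hx : ∀ s, 1 ≤ s → s ≤ t → Measurable (x s))
    (hζ : ∀ s, 1 ≤ s → s < t → Measurable (ζ s)) :
    Measurable fun ω => crossTerm (fun s => x s ω) (fun s => ζ s ω) t :=
  measurable_dotProduct_mulVec (measurable_designMatrix_inv ht fun s h1 h2 => hx s h1 h2.le)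
    (measurable_coord (hx t ht le_rfl))
    (measurable_noiseSum (fun s h1 h2 => hx s h1 h2.le) hζ)

lemma measurable_det_designMatrix {t : ℕ} (ht : 1 ≤ t)
    (hx : ∀ s, 1 ≤ s → s < t → Measurable (x s)) :
    Measurable fun ω => (designMatrix (fun s => x s ω) t).det := by
  induction t, ht using Nat.le_induction with
  | base => simp [designMatrix_one]
  | succ t ht ih =>
    simp_rw [fun ω => det_designMatrix_succ (fun s => x s ω) ht]
    exact (ih fun s h1 h2 => hx s h1 (by omega)).mul
      ((measurable_invNormSq ht fun s h1 h2 => hx s h1 (by omega)).const_add 1)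

lemma measurable_mixtureWeight {t : ℕ} (ht : 1 ≤ t) (hx : ∀ s, 1 ≤ s → s < t → Measurable (x s))
    (hζ : ∀ s, 1 ≤ s → s < t → Measurable (ζ s)) :
    Measurable fun ω => mixtureWeight (fun s => x s ω) (fun s => ζ s ω) t :=
  ((measurable_dotProduct_mulVec (measurable_designMatrix_inv ht hx) (measurable_noiseSum hx hζ)
    (measurable_noiseSum hx hζ)).div_const 2).exp.div (measurable_det_designMatrix ht hx).sqrt

end Measurability

/-! ### Tail bounds -/

section Tail

variable {Ω : Type*} [mΩ : MeasurableSpace Ω] {μ : Measure Ω} [IsProbabilityMeasure μ]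
  {𝒢 : Filtration ℕ mΩ} {d : ℕ} {x : ℕ → Ω → EuclideanSpace ℝ (Fin d)} {ζ : ℕ → Ω → ℝ}

/-- The self-normalised tail bound of the method of mixtures. -/
lemma measure_exists_mixtureWeight_ge_le (hx : ∀ t, 1 ≤ t → Measurable[𝒢 t] (x t))
    (hζ : ∀ t, 1 ≤ t → Measurable[𝒢 (t + 1)] (ζ t))
    (hsub : ∀ t, 1 ≤ t → CondSubGaussian (𝒢 t) μ (ζ t)) {c : ℝ} (hc : 0 < c) :
    μ {ω | ∃ t, 1 ≤ t ∧ c ≤ mixtureWeight (fun s => x s ω) (fun s => ζ s ω) t} ≤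
      ENNReal.ofReal (1 / c) := by
  have hx' : ∀ s t, 1 ≤ s → s ≤ t → Measurable[𝒢 t] (x s) := fun s t h1 h2 =>
    (hx s h1).mono (𝒢.mono h2) le_rfl
  have hζ' : ∀ s t, 1 ≤ s → s < t → Measurable[𝒢 t] (ζ s) := fun s t h1 h2 =>
    (hζ s h1).mono (𝒢.mono h2) le_rfl
  have hM : ∀ t, 1 ≤ t → Measurable[𝒢 t]
      fun ω => ENNReal.ofReal (mixtureWeight (fun s => x s ω) (fun s => ζ s ω) t) := fun t ht =>
    (@measurable_mixtureWeight Ω (𝒢 t) d x ζ t ht (fun s h1 h2 => hx' s t h1 h2.le)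
      fun s h1 h2 => hζ' s t h1 h2).ennreal_ofReal
  have key := mul_measure_exists_ge_le (μ := μ) (𝒢 := 𝒢) hM ?_ (ENNReal.ofReal c)
  · simp only [mixtureWeight_one, ENNReal.ofReal_one, lintegral_const, measure_univ, mul_one,
      ENNReal.ofReal_le_ofReal_iff (mixtureWeight_pos _ _ _).le] at key
    rw [one_div, ENNReal.ofReal_inv_of_pos hc, ENNReal.le_inv_iff_mul_le, mul_comm]
    exact key
  · intro t ht B hB
    have hB' := 𝒢.le t _ hB
    rw [← lintegral_indicator hB', ← lintegral_indicator hB']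
    refine le_trans (le_of_eq ?_) ((hsub t ht).lintegral_mul_mixture_le (𝒢.le t)
      ((hζ t ht).mono (𝒢.le _) le_rfl)
      (@measurable_crossTerm Ω (𝒢 t) d x ζ t ht (fun s h1 h2 => hx' s t h1 h2)
        fun s h1 h2 => hζ' s t h1 h2)
      (@measurable_invNormSq Ω (𝒢 t) d x t ht fun s h1 h2 => hx' s t h1 h2)
      (fun ω => invNormSq_nonneg _ _ _) ((hM t ht).indicator hB))
    refine lintegral_congr fun ω => ?_
    by_cases hω : ω ∈ B
    · simp only [Set.indicator_of_mem hω]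
      rw [← ENNReal.ofReal_mul (mixtureWeight_pos _ _ _).le,
        mixtureWeight_succ (fun s => x s ω) (fun s => ζ s ω) ht]
    · simp [Set.indicator_of_notMem hω]

lemma lintegral_exp_sum_le (hζ : ∀ t, 1 ≤ t → Measurable[𝒢 (t + 1)] (ζ t))
    (hsub : ∀ t, 1 ≤ t → CondSubGaussian (𝒢 t) μ (ζ t)) (l : ℝ) (t : ℕ) :
    ∫⁻ ω, ENNReal.ofReal (Real.exp (l * ∑ s ∈ Finset.Icc 1 t, ζ s ω - t * (l ^ 2 / 2))) ∂μ ≤ 1 := by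
  induction t with
  | zero => simp
  | succ t ih =>
    refine le_trans (le_trans (le_of_eq ?_) ((hsub (t + 1) (by omega)).lintegral_mul_exp_le
      (𝒢.le _) ((hζ (t + 1) (by omega)).mono (𝒢.le _) le_rfl)
      (l := fun _ => l) (@measurable_const _ _ _ (𝒢 (t + 1)) _)
      (D := fun ω => ENNReal.ofReal
        (Real.exp (l * ∑ s ∈ Finset.Icc 1 t, ζ s ω - t * (l ^ 2 / 2)))) ?_)) ih
    · refine lintegral_congr fun ω => ?_
      rw [← ENNReal.ofReal_mul (Real.exp_pos _).le, ← Real.exp_add,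
        Finset.sum_Icc_succ_top (by omega)]
      congr 2
      push_cast
      ring
    · have : Measurable[𝒢 (t + 1)] fun ω => ∑ s ∈ Finset.Icc 1 t, ζ s ω :=
        @Finset.measurable_sum _ _ _ _ _ _ (𝒢 (t + 1)) _ _ fun s hs =>
          (hζ s (Finset.mem_Icc.1 hs).1).mono
            (𝒢.mono (by have := (Finset.mem_Icc.1 hs).2; omega)) le_rfl
      exact ((this.const_mul l).sub_const _).exp.ennreal_ofReal

/-- The Chernoff bound for the sum of the noise. -/
lemma measure_sum_ge_le (hζ : ∀ t, 1 ≤ t → Measurable[𝒢 (t + 1)] (ζ t))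
    (hsub : ∀ t, 1 ≤ t → CondSubGaussian (𝒢 t) μ (ζ t)) {t : ℕ} (ht : 1 ≤ t) {b : ℝ} (hb : 0 ≤ b) :
    μ {ω | b ≤ ∑ s ∈ Finset.Icc 1 t, ζ s ω} ≤ ENNReal.ofReal (Real.exp (-(b ^ 2 / (2 * t)))) := by
  have ht' : (0 : ℝ) < t := by exact_mod_cast ht
  set e := ENNReal.ofReal (Real.exp (b ^ 2 / (2 * t))) with he
  have he0 : 0 < e := ENNReal.ofReal_pos.2 (Real.exp_pos _)
  have h1 : e * μ {ω | b ≤ ∑ s ∈ Finset.Icc 1 t, ζ s ω} ≤ 1 := by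
    -- The multiplier b/t maximises l·b - t·l²/2.
    refine le_trans ?_ (lintegral_exp_sum_le hζ hsub (b / t) t)
    have hm : Measurable fun ω => ∑ s ∈ Finset.Icc 1 t, ζ s ω :=
      Finset.measurable_sum _ fun s hs => (hζ s (Finset.mem_Icc.1 hs).1).mono (𝒢.le _) le_rfl
    refine le_trans ?_ (mul_meas_ge_le_lintegral₀
      ((hm.const_mul (b / t)).sub_const _).exp.ennreal_ofReal.aemeasurable e)
    gcongr with ω hω
    intro hω
    rw [he]
    refine ENNReal.ofReal_le_ofReal (Real.exp_le_exp.2 ?_)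
    have h2 := mul_le_mul_of_nonneg_left hω (div_nonneg hb ht'.le)
    have h3 : b / t * b - t * ((b / t) ^ 2 / 2) = b ^ 2 / (2 * t) := by
      field_simp
      ring
    linarith
  rw [Real.exp_neg, ENNReal.ofReal_inv_of_pos (Real.exp_pos _), ENNReal.le_inv_iff_mul_le, mul_comm]
  exact h1

/-- A time uniform threshold for the sum of the noise. -/
noncomputable def noiseThreshold (δ : ℝ) (t : ℕ) : ℝ :=
  if t = 1 then 2 * √(Real.log (22 / δ)) - 2 else √(2 * t * Real.log (t * (t + 1) / δ))

lemma one_le_log_div {δ : ℝ} (hδ0 : 0 < δ) (hδ1 : δ < 1 / 2) : 1 ≤ Real.log (22 / δ) := by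
  rw [Real.le_log_iff_exp_le (by positivity), le_div_iff₀ hδ0]
  have := Real.exp_one_lt_d9
  nlinarith [Real.exp_pos 1]

/-- With L² = log(22/δ), (L - 2)² ≥ 0 bounds the exponent by 2 - L², and e²/22 ≤ 8/22 ≤ 3/8. The
threshold at t = 1 is the LIL term less 2, the room needed for the first-round gap. -/
lemma exp_first_threshold_le {δ : ℝ} (hδ0 : 0 < δ) (hδ1 : δ < 1 / 2) :
    Real.exp (-((2 * √(Real.log (22 / δ)) - 2) ^ 2 / 2)) ≤ 3 / 8 * δ := by
  have hL := Real.sq_sqrt (zero_le_one.trans (one_le_log_div hδ0 hδ1))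
  have hδ : δ = 22 * Real.exp (-Real.log (22 / δ)) := by
    rw [Real.exp_neg, Real.exp_log (by positivity)]
    field_simp
  generalize √(Real.log (22 / δ)) = L at *
  rw [← hL] at hδ
  have h2 : Real.exp 2 ≤ 8 := by
    have h := Real.exp_one_lt_d9
    rw [show (2 : ℝ) = 1 + 1 by norm_num, Real.exp_add]
    nlinarith [Real.exp_pos 1]
  calc Real.exp (-((2 * L - 2) ^ 2 / 2)) ≤ Real.exp (2 + -L ^ 2) :=
        Real.exp_le_exp.2 (by nlinarith [sq_nonneg (L - 2)])
    _ = Real.exp 2 * Real.exp (-L ^ 2) := Real.exp_add _ _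
    _ ≤ 8 * Real.exp (-L ^ 2) := by gcongr
    _ ≤ 3 / 8 * δ := by
        rw [hδ]
        linarith [Real.exp_pos (-L ^ 2)]

lemma measure_exists_noiseThreshold_le (hζ : ∀ t, 1 ≤ t → Measurable[𝒢 (t + 1)] (ζ t))
    (hsub : ∀ t, 1 ≤ t → CondSubGaussian (𝒢 t) μ (ζ t)) {δ : ℝ} (hδ0 : 0 < δ) (hδ1 : δ < 1 / 2) :
    μ {ω | ∃ t, 1 ≤ t ∧ noiseThreshold δ t ≤ ∑ s ∈ Finset.Icc 1 t, ζ s ω} ≤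
      ENNReal.ofReal (7 / 8 * δ) := by
  have hsub' : {ω | ∃ t, 1 ≤ t ∧ noiseThreshold δ t ≤ ∑ s ∈ Finset.Icc 1 t, ζ s ω} ⊆
      {ω | noiseThreshold δ 1 ≤ ∑ s ∈ Finset.Icc 1 1, ζ s ω} ∪
      ⋃ n : ℕ, {ω | noiseThreshold δ (n + 2) ≤ ∑ s ∈ Finset.Icc 1 (n + 2), ζ s ω} := by
    rintro ω ⟨t, ht, h⟩
    rcases Nat.lt_or_ge t 2 with h2 | h2
    · obtain rfl : t = 1 := by omega
      exact Or.inl h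
    · obtain ⟨n, rfl⟩ := Nat.exists_eq_add_of_le' h2
      exact Or.inr (Set.mem_iUnion.2 ⟨n, h⟩)
  have h1 : μ {ω | noiseThreshold δ 1 ≤ ∑ s ∈ Finset.Icc 1 1, ζ s ω} ≤
      ENNReal.ofReal (3 / 8 * δ) := by
    refine (measure_sum_ge_le hζ hsub le_rfl ?_).trans (ENNReal.ofReal_le_ofReal ?_)
    · have := Real.one_le_sqrt.2 (one_le_log_div hδ0 hδ1)
      simp only [noiseThreshold, if_true]
      linarith
    · simpa [noiseThreshold] using exp_first_threshold_le hδ0 hδ1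
  -- At t = n + 2 the Chernoff bound is δ/(t(t+1)), a telescoping term; summed over t ≥ 2 it gives
  -- δ/2, which with 3δ/8 from t = 1 makes 7δ/8.
  have h2 : ∀ n : ℕ, μ {ω | noiseThreshold δ (n + 2) ≤ ∑ s ∈ Finset.Icc 1 (n + 2), ζ s ω} ≤
      ENNReal.ofReal (δ * (1 / ((n : ℝ) + 2) - 1 / ((n : ℝ) + 3))) := by
    intro n
    have hthr : noiseThreshold δ (n + 2) =
        √(2 * (n + 2 : ℕ) * Real.log ((n + 2 : ℕ) * ((n + 2 : ℕ) + 1) / δ)) := by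
      simp [noiseThreshold]
    refine (measure_sum_ge_le hζ hsub (by omega) ?_).trans (ENNReal.ofReal_le_ofReal (le_of_eq ?_))
    · rw [hthr]
      exact Real.sqrt_nonneg _
    · have harg : 1 ≤ ((n + 2 : ℕ) : ℝ) * ((n + 2 : ℕ) + 1) / δ := by
        rw [le_div_iff₀ hδ0]
        push_cast
        nlinarith [Nat.cast_nonneg (α := ℝ) n]
      have hn : ((n + 2 : ℕ) : ℝ) ≠ 0 := by positivity
      rw [hthr, Real.sq_sqrt (mul_nonneg (by positivity) (Real.log_nonneg harg)),
        mul_div_cancel_left₀ _ (mul_ne_zero two_ne_zero hn), Real.exp_neg,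
        Real.exp_log (by linarith)]
      push_cast
      field_simp
      ring
  have h3 : ∑' n : ℕ, ENNReal.ofReal (δ * (1 / ((n : ℝ) + 2) - 1 / ((n : ℝ) + 3))) ≤
      ENNReal.ofReal (1 / 2 * δ) := by
    refine ENNReal.tsum_le_of_sum_range_le fun N => ?_
    have hpos : ∀ n : ℕ, 0 ≤ δ * (1 / ((n : ℝ) + 2) - 1 / ((n : ℝ) + 3)) := fun n =>
      mul_nonneg hδ0.le (sub_nonneg.2 (one_div_le_one_div_of_le (by positivity) (by linarith)))
    rw [← ENNReal.ofReal_sum_of_nonneg fun n _ => hpos n]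
    refine ENNReal.ofReal_le_ofReal ?_
    have hsum : ∑ n ∈ Finset.range N, δ * (1 / ((n : ℝ) + 2) - 1 / ((n : ℝ) + 3)) =
        δ * (1 / 2 - 1 / ((N : ℝ) + 2)) := by
      induction N with
      | zero => simp
      | succ N ih =>
        rw [Finset.sum_range_succ, ih]
        push_cast
        ring
    rw [hsum]
    have : 0 ≤ 1 / ((N : ℝ) + 2) := by positivity
    nlinarith
  calc _ ≤ _ := measure_mono hsub'
    _ ≤ _ := measure_union_le _ _
    _ ≤ ENNReal.ofReal (3 / 8 * δ) + ENNReal.ofReal (1 / 2 * δ) :=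
        add_le_add h1 ((measure_iUnion_le _).trans ((ENNReal.tsum_le_tsum h2).trans h3))
    _ = _ := by
        rw [← ENNReal.ofReal_add (by positivity) (by positivity)]
        ring_nf

end Tail

/-! ### The noise of the bandit interaction -/

section Interaction

variable {Ω : Type*} [mΩ : MeasurableSpace Ω] {m d : ℕ} {μ : Measure Ω}
  {𝒢 : Filtration ℕ mΩ} {A : Matrix (Fin m) (Fin d) ℝ} {x : ℕ → Ω → EuclideanSpace ℝ (Fin d)}
  {i : ℕ → Ω → Fin m} {S : ℕ → Ω → EuclideanSpace ℝ (Fin m)}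

lemma BanditInteraction.condSubGaussian_coord [IsProbabilityMeasure μ]
    (h : BanditInteraction μ 𝒢 A x i S) {t : ℕ}
    (ht : 1 ≤ t) (k : Fin m) : CondSubGaussian (𝒢 t) μ fun ω => noise A x S t ω k := by
  intro l B hB
  have hexp : ∀ ω, Real.exp (inner ℝ (EuclideanSpace.single k l) (noise A x S t ω)) =
      Real.exp (l * noise A x S t ω k) := fun ω => by
    rw [EuclideanSpace.inner_single_left]
    simp
  -- The vector condition is tested in the direction l·e_k, whose norm is |l|.
  have hint := h.exp_integrable t ht (EuclideanSpace.single k l)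
  have hle := h.noise_subGaussian t ht (EuclideanSpace.single k l)
  have heq := setIntegral_condExp (𝒢.le t) hint hB
  rw [PiLp.norm_single, Real.norm_eq_abs, sq_abs] at hle
  simp_rw [hexp] at hint hle heq
  rw [← ofReal_integral_eq_lintegral_ofReal hint.integrableOn
    (ae_of_all _ fun ω => (Real.exp_pos _).le), ← heq]
  calc _ ≤ ENNReal.ofReal (∫ _ in B, Real.exp (l ^ 2 / 2) ∂μ) := by
        refine ENNReal.ofReal_le_ofReal ?_
        exact integral_mono_ae integrable_condExp.integrableOn (integrable_const _)
          (ae_restrict_of_ae hle)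
    _ = _ := by
        rw [setIntegral_const, smul_eq_mul, mul_comm, ENNReal.ofReal_mul (Real.exp_pos _).le,
          measureReal_def, ENNReal.ofReal_toReal (measure_ne_top _ _)]

lemma BanditInteraction.measurable_noise_coord (h : BanditInteraction μ 𝒢 A x i S) {t : ℕ}
    (ht : 1 ≤ t) (k : Fin m) : Measurable[𝒢 (t + 1)] fun ω => noise A x S t ω k :=
  (@measurable_coord Ω (𝒢 (t + 1)) m _ (h.score_measurable t (t + 1) ht (Nat.lt_succ_self t)) k).sub
    (@measurable_meanScore_apply Ω (𝒢 (t + 1)) d m A _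
      ((h.action_measurable t ht).mono (𝒢.mono (Nat.le_succ t)) le_rfl) k)

lemma BanditInteraction.measurable_noise_selected (h : BanditInteraction μ 𝒢 A x i S) {t : ℕ}
    (ht : 1 ≤ t) : Measurable[𝒢 (t + 1)] fun ω => noise A x S t ω (i t ω) :=
  @measurable_eval Ω (𝒢 (t + 1)) (Fin m) _ _ _ (fun k ω => noise A x S t ω k)
    (h.measurable_noise_coord ht) _
    ((h.constraint_measurable t ht).mono (𝒢.mono (Nat.le_succ t)) le_rfl)

lemma BanditInteraction.condSubGaussian_selected [IsProbabilityMeasure μ]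
    (h : BanditInteraction μ 𝒢 A x i S) {t : ℕ}
    (ht : 1 ≤ t) : CondSubGaussian (𝒢 t) μ fun ω => noise A x S t ω (i t ω) :=
  CondSubGaussian.eval (𝒢.le t) (f := fun k ω => noise A x S t ω k) (h.condSubGaussian_coord ht)
    (h.constraint_measurable t ht)

/-- The confidence event fails with probability at most `δ / 8`. -/
lemma BanditInteraction.measure_not_confident_le [IsProbabilityMeasure μ]
    (h : BanditInteraction μ 𝒢 A x i S)
    (hm : 1 ≤ m) {δ : ℝ} (hδ : 0 < δ) :
    μ {ω | ¬ Confident A (fun t => x t ω) (fun t => S t ω) (Real.log (8 * m / δ))} ≤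
      ENNReal.ofReal (δ / 8) := by
  have hm' : (0 : ℝ) < m := by exact_mod_cast hm
  have hc : 0 < 8 * m / δ := by positivity
  calc _ ≤ μ (⋃ k : Fin m, {ω | ∃ t, 1 ≤ t ∧ 8 * m / δ ≤
        mixtureWeight (fun s => x s ω) (fun s => noise A x S s ω k) t}) := by
        refine measure_mono fun ω hω => ?_
        by_contra hcon
        refine hω fun t ht k => ?_
        simp only [Set.mem_iUnion, Set.mem_ofPred_eq, not_exists, not_and, not_le] at hcon
        exact selfNormSq_le_of_mixtureWeight_le _ _ (hcon k t ht).le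
    _ ≤ ∑ k : Fin m, μ {ω | ∃ t, 1 ≤ t ∧ 8 * m / δ ≤
        mixtureWeight (fun s => x s ω) (fun s => noise A x S s ω k) t} :=
        measure_iUnion_fintype_le _ _
    _ ≤ ∑ _k : Fin m, ENNReal.ofReal (1 / (8 * m / δ)) :=
        Finset.sum_le_sum fun k _ => measure_exists_mixtureWeight_ge_le h.action_measurable
          (fun t ht => h.measurable_noise_coord ht k)
          (fun t ht => h.condSubGaussian_coord ht k) hc
    _ = _ := by
        rw [Finset.sum_const, Finset.card_univ, Fintype.card_fin, ← ENNReal.ofReal_nsmul]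
        congr 1
        rw [nsmul_eq_mul]
        field_simp

end Interaction

/-! ### Boundaries -/

section Boundary

lemma noiseThreshold_one (δ : ℝ) : noiseThreshold δ 1 = 2 * √(Real.log (22 / δ)) - 2 := if_pos rfl

lemma lil_one (δ : ℝ) : lil 1 (δ / 2) = 2 * √(Real.log (22 / δ)) := by
  have h : (11 : ℝ) * max (Real.log (1 : ℕ)) 1 / (δ / 2) = 22 / δ := by
    rw [Nat.cast_one, Real.log_one, max_eq_right zero_le_one, div_div_eq_mul_div]
    norm_num
  rw [lil, h, Nat.cast_one, mul_one, Real.sqrt_mul (by norm_num), show (4 : ℝ) = 2 ^ 2 by norm_num,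
    Real.sqrt_sq (by norm_num)]

/-- Since log 1 = 0 only the LIL term survives; the slack 2 covers the distance between Γ and a
score, both in [-1, 1]. -/
lemma boundaryF_one (m d : ℕ) (δ : ℝ) : boundaryF m d 1 δ = noiseThreshold δ 1 + 2 := by
  rw [boundaryF, lil_one, noiseThreshold_one]
  simp

lemma boundaryI_one (m d : ℕ) (δ : ℝ) : boundaryI m d 1 δ = noiseThreshold δ 1 + 2 := by
  rw [boundaryI, lil_one, noiseThreshold_one]
  simp

lemma log_succ_le_two_mul_log {t : ℕ} (ht : 2 ≤ t) :
    Real.log ((t : ℝ) + 1) ≤ 2 * Real.log t := by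
  have h : (2 : ℝ) ≤ t := by exact_mod_cast ht
  have := Real.log_le_log (by linarith) (show (t : ℝ) + 1 ≤ t ^ 2 by nlinarith)
  rwa [Real.log_pow] at this

lemma log_ge_of_two_le {t : ℕ} (ht : 2 ≤ t) : 0.69 ≤ Real.log (t : ℝ) := by
  have := Real.log_le_log (by norm_num) (show (2 : ℝ) ≤ t by exact_mod_cast ht)
  linarith [Real.log_two_gt_d9]

variable {m d : ℕ} {δ : ℝ}

lemma log_level_ge (hm : 1 ≤ m) (hδ0 : 0 < δ) (hδ1 : δ < 1 / 2) :
    2.76 ≤ Real.log (8 * m / δ) := by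
  have hm' : (1 : ℝ) ≤ m := by exact_mod_cast hm
  have h : (2 : ℝ) ^ 4 ≤ 8 * m / δ := by
    rw [le_div_iff₀ hδ0]
    nlinarith
  have := Real.log_le_log (by norm_num) h
  rw [Real.log_pow] at this
  push_cast at this
  linarith [Real.log_two_gt_d9]

/-- Extracts the common factor √(dt), so that comparing with the boundaries becomes an inequality in
d, log t and log(8m/δ) alone. -/
lemma noiseThreshold_le (hd : 1 ≤ d) (hm : 1 ≤ m) (hδ0 : 0 < δ) (hδ1 : δ < 1 / 2) {t : ℕ}
    (ht : 2 ≤ t) :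
    noiseThreshold δ t ≤
      √((d : ℝ) * t) * √(6 * Real.log t + 2 * Real.log (8 * m / δ)) := by
  have hm' : (1 : ℝ) ≤ m := by exact_mod_cast hm
  have hd' : (1 : ℝ) ≤ d := by exact_mod_cast hd
  have ht' : (2 : ℝ) ≤ t := by exact_mod_cast ht
  have h1 : Real.log (t * (t + 1) / δ) ≤ 3 * Real.log t + Real.log (8 * m / δ) := by
    have h2 := log_succ_le_two_mul_log ht
    have h3 : Real.log (1 / δ) ≤ Real.log (8 * m / δ) :=
      Real.log_le_log (by positivity) (by gcongr; linarith)
    rw [div_eq_mul_one_div, Real.log_mul (by positivity) (by positivity),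
      Real.log_mul (by positivity) (by positivity)]
    linarith
  have h0 : 0 ≤ Real.log (t * (t + 1) / δ) := by
    refine Real.log_nonneg ?_
    rw [le_div_iff₀ hδ0]
    nlinarith
  rw [noiseThreshold, if_neg (by omega), ← Real.sqrt_mul (by positivity)]
  refine Real.sqrt_le_sqrt ?_
  calc 2 * (t : ℝ) * Real.log (t * (t + 1) / δ)
      = 1 * t * (2 * Real.log (t * (t + 1) / δ)) := by ring
    _ ≤ d * t * (6 * Real.log t + 2 * Real.log (8 * m / δ)) := by
        gcongr
        linarith

lemma regret_add_noiseThreshold_le_boundaryF (hd : 1 ≤ d) (hm : 1 ≤ m) (hδ0 : 0 < δ)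
    (hδ1 : δ < 1 / 2) {t : ℕ} (ht : 2 ≤ t) :
    √((d : ℝ) * t) * (10 * (d * Real.log (t + 1)) + 4 * Real.log (8 * m / δ)) +
      noiseThreshold δ t ≤ boundaryF m d t δ := by
  have h1 := noiseThreshold_le hd hm hδ0 hδ1 ht
  have h2 := log_succ_le_two_mul_log ht
  have h3 := log_ge_of_two_le ht
  have h4 := log_level_ge hm hδ0 hδ1
  have h5 : 0 ≤ lil t (δ / 2) := Real.sqrt_nonneg _
  have hd' : (1 : ℝ) ≤ d := by exact_mod_cast hd
  rw [boundaryF, Real.sqrt_mul (show (0 : ℝ) ≤ d * t by positivity), show Real.log (t : ℝ) ^ 4 =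
    (Real.log (t : ℝ) ^ 2) ^ 2 by ring, Real.sqrt_sq (by positivity)]
  generalize Real.log ((t : ℝ) + 1) = l' at *
  generalize Real.log (t : ℝ) = l at *
  generalize Real.log (8 * m / δ) = ℓ at *
  -- Powers of l are raised at the cost of factors 0.69, from l ≥ log 2; l' ≤ 2l fails at t = 1,
  -- which is treated apart.
  have key : 10 * (d * l') + 4 * ℓ + √(6 * l + 2 * ℓ) ≤ 45 * l ^ 2 * (d + ℓ) := by
    have h6 : √(6 * l + 2 * ℓ) ≤ 3 * l + 2 * ℓ := by
      rw [Real.sqrt_le_left (by linarith)]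
      nlinarith
    have h7 : d * l' ≤ 2 * (d * l) := by nlinarith
    have h8 : 0.69 * l ≤ l ^ 2 := by nlinarith
    have h9 : l ≤ d * l := by nlinarith
    have h10 : 0.69 * (d * l) ≤ l ^ 2 * d := by nlinarith
    have h11 : 0.47 * ℓ ≤ l ^ 2 * ℓ := by nlinarith
    nlinarith
  have := mul_le_mul_of_nonneg_left key (Real.sqrt_nonneg ((d : ℝ) * t))
  linarith

lemma gap_add_noiseThreshold_le_boundaryI (hd : 1 ≤ d) (hm : 1 ≤ m) (hδ0 : 0 < δ)
    (hδ1 : δ < 1 / 2) {t : ℕ} (ht : 2 ≤ t) :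
    √((d : ℝ) * t) * (2 * (1 + √(d * Real.log (t + 1) + 2 * Real.log (8 * m / δ))) *
      √(2 * Real.log (t + 1))) + noiseThreshold δ t ≤ boundaryI m d t δ := by
  have h1 := noiseThreshold_le hd hm hδ0 hδ1 ht
  have h2 := log_succ_le_two_mul_log ht
  have h3 := log_ge_of_two_le ht
  have h4 := log_level_ge hm hδ0 hδ1
  have h5 : 0 ≤ lil t (δ / 2) := Real.sqrt_nonneg _
  have hd' : (1 : ℝ) ≤ d := by exact_mod_cast hd
  rw [boundaryI, Real.sqrt_mul (show (0 : ℝ) ≤ d * t by positivity)]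
  generalize Real.log ((t : ℝ) + 1) = l' at *
  generalize Real.log (t : ℝ) = l at *
  generalize Real.log (8 * m / δ) = ℓ at *
  have hw : √l ^ 2 = l := Real.sq_sqrt (by linarith)
  have hD : √(d : ℝ) ^ 2 = d := Real.sq_sqrt (by linarith)
  have hw0 : 0.83 ≤ √l := Real.le_sqrt_of_sq_le (by norm_num at h3 ⊢; linarith)
  have hD1 : 1 ≤ √(d : ℝ) := Real.one_le_sqrt.2 hd'
  have hl3 : √(l ^ 3) = √l ^ 3 := by
    rw [Real.sqrt_eq_iff_eq_sq (by positivity) (by positivity), ← pow_mul, mul_comm 3 2, pow_mul,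
      hw]
  have hu : √(2 * l') ≤ 2 * √l := by
    rw [Real.sqrt_le_left (by positivity)]
    nlinarith
  have hc : √(d * l' + 2 * ℓ) ≤ 3 / 2 * (√d * √l) + ℓ := by
    rw [Real.sqrt_le_left (by positivity)]
    have h6 : d * l' ≤ 2 * (d * l) := by nlinarith
    have h7 : (√(d : ℝ) * √l) ^ 2 = d * l := by rw [mul_pow, hD, hw]
    have h8 : 0 ≤ √(d : ℝ) * √l * ℓ := by positivity
    have h9 : 0 ≤ d * l := by positivity
    nlinarith
  have hn : √(6 * l + 2 * ℓ) ≤ 3 * l + ℓ := by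
    rw [Real.sqrt_le_left (by linarith)]
    nlinarith
  -- With w = √l and D = √d both sides are polynomials in w, D and ℓ; w ≥ 0.83 lifts every monomial
  -- on the left to w³D or w³ℓ.
  have key : 2 * (1 + √(d * l' + 2 * ℓ)) * √(2 * l') + √(6 * l + 2 * ℓ) ≤
      27 * √(l ^ 3) * (√d + ℓ) := by
    rw [hl3]
    have h6 : 2 * (1 + √(d * l' + 2 * ℓ)) * √(2 * l') ≤
        2 * (1 + (3 / 2 * (√d * √l) + ℓ)) * (2 * √l) := by gcongr
    generalize √l = w at *
    generalize √(d : ℝ) = D at *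
    subst hw
    have hw2 : 0.83 * w ≤ w ^ 2 := by nlinarith
    have hw3 : 0.83 * w ^ 2 ≤ w ^ 3 := by nlinarith [sq_nonneg w]
    have hw4 : 0.68 * w ≤ w ^ 3 := by nlinarith
    have hw5 : 0.57 ≤ w ^ 3 := by nlinarith
    have e1 : 0.83 * (w ^ 2 * D) ≤ w ^ 3 * D := by nlinarith
    have e2 : 0.68 * (w * ℓ) ≤ w ^ 3 * ℓ := by nlinarith
    have e3 : 0.57 * ℓ ≤ w ^ 3 * ℓ := by nlinarith
    have e4 : w ^ 2 ≤ w ^ 2 * D := by nlinarith [sq_nonneg w]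
    have e5 : w ≤ w * ℓ := by nlinarith
    have e6 : 0 ≤ w ^ 3 * D := by positivity
    linarith
  have := mul_le_mul_of_nonneg_left key (Real.sqrt_nonneg ((d : ℝ) * t))
  linarith

end Boundary

/-! ### Conclusions along one trajectory -/

section Conclusion

variable {m d : ℕ} {𝒳 : Set (EuclideanSpace ℝ (Fin d))} {A : Matrix (Fin m) (Fin d) ℝ}
  {x : ℕ → EuclideanSpace ℝ (Fin d)} {i : ℕ → Fin m} {S : ℕ → EuclideanSpace ℝ (Fin m)} {δ : ℝ}

lemma statistic_eq (A : Matrix (Fin m) (Fin d) ℝ) (x : ℕ → EuclideanSpace ℝ (Fin d))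
    (i : ℕ → Fin m) (S : ℕ → EuclideanSpace ℝ (Fin m)) (t : ℕ) :
    statistic i S t = ∑ s ∈ Finset.Icc 1 t, meanScore A (x s) (i s) +
      ∑ s ∈ Finset.Icc 1 t, (S s - meanScore A (x s)) (i s) := by
  rw [statistic, ← Finset.sum_add_distrib]
  exact Finset.sum_congr rfl fun s _ => by simp

lemma le_statistic_of_confident (hd : 1 ≤ d) (hbdd : BoundedInstance 𝒳 A)
    (hsel : TemperedSelection 𝒳 x i S) (hδ0 : 0 < δ) (hδ1 : δ < 1 / 2)
    (hconf : Confident A x S (Real.log (8 * m / δ)))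
    (hnoise : ∀ t, 1 ≤ t → -∑ s ∈ Finset.Icc 1 t, (S s - meanScore A (x s)) (i s) <
      noiseThreshold δ t) {t : ℕ} (ht : 1 ≤ t) :
    t * signalLevel 𝒳 A - boundaryF m d t δ ≤ statistic i S t := by
  have hm : 1 ≤ m := Nat.one_le_iff_ne_zero.2 fun h => (h ▸ i 0).elim0
  have hn := hnoise t ht
  rw [statistic_eq A x]
  rcases Nat.eq_or_lt_of_le ht with rfl | ht2
  · have hx := (hsel 1 le_rfl).1
    have h1 := (abs_le.1 (abs_meanScore_le hbdd hx (i 1))).1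
    have h2 := (abs_le.1 (abs_signalLevel_le hbdd (i 1) hx)).2
    rw [boundaryF_one]
    simp only [Finset.Icc_self, Finset.sum_singleton, Nat.cast_one, one_mul] at hn ⊢
    linarith
  · have h1 := hconf.sum_signalLevel_sub_le hd hbdd hsel
      (by linarith [log_level_ge hm hδ0 hδ1]) ht
    have h2 := regret_add_noiseThreshold_le_boundaryF hd hm hδ0 hδ1 ht2
    rw [Finset.sum_sub_distrib, Finset.sum_const, Nat.card_Icc, nsmul_eq_mul,
      Nat.add_sub_cancel] at h1
    linarith

lemma statistic_le_of_confident (hd : 1 ≤ d) (hbdd : BoundedInstance 𝒳 A)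
    (hsel : TemperedSelection 𝒳 x i S) (hδ0 : 0 < δ) (hδ1 : δ < 1 / 2)
    (hconf : Confident A x S (Real.log (8 * m / δ)))
    (hnoise : ∀ t, 1 ≤ t → ∑ s ∈ Finset.Icc 1 t, (S s - meanScore A (x s)) (i s) <
      noiseThreshold δ t) {t : ℕ} (ht : 1 ≤ t) :
    statistic i S t ≤ t * signalLevel 𝒳 A + boundaryI m d t δ := by
  have hm : 1 ≤ m := Nat.one_le_iff_ne_zero.2 fun h => (h ▸ i 0).elim0
  have hn := hnoise t ht
  rw [statistic_eq A x]
  rcases Nat.eq_or_lt_of_le ht with rfl | ht2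
  · have hx := (hsel 1 le_rfl).1
    have h1 := (abs_le.1 (abs_meanScore_le hbdd hx (i 1))).2
    have h2 := (abs_le.1 (abs_signalLevel_le hbdd (i 1) hx)).1
    rw [boundaryI_one]
    simp only [Finset.Icc_self, Finset.sum_singleton, Nat.cast_one, one_mul] at hn ⊢
    linarith
  · have h1 := hconf.sum_meanScore_sub_signalLevel_le hd hbdd hsel t
    have h2 := gap_add_noiseThreshold_le_boundaryI hd hm hδ0 hδ1 ht2
    rw [Finset.sum_sub_distrib, Finset.sum_const, Nat.card_Icc, nsmul_eq_mul,
      Nat.add_sub_cancel] at h1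
    linarith

lemma pseudoRegret_eq {A : Matrix (Fin 1) (Fin d) ℝ} (k : Fin 1) (x : ℕ → EuclideanSpace ℝ (Fin d))
    (i : ℕ → Fin 1) (t : ℕ) :
    pseudoRegret 𝒳 (A k) x t =
      ∑ s ∈ Finset.Icc 1 t, (signalLevel 𝒳 A - meanScore A (x s) (i s)) := by
  have h : minScore A = fun y : EuclideanSpace ℝ (Fin d) => A k ⬝ᵥ y.ofLp := by
    ext y
    rw [minScore, ciInf_unique, meanScore_apply, Subsingleton.elim default k]
  rw [pseudoRegret, signalLevel, h]
  refine Finset.sum_congr rfl fun s _ => ?_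
  rw [meanScore_apply, Subsingleton.elim (i s) k]

lemma pseudoRegret_le_of_confident {A : Matrix (Fin 1) (Fin d) ℝ} {i : ℕ → Fin 1}
    {S : ℕ → EuclideanSpace ℝ (Fin 1)} (hd : 1 ≤ d) (hbdd : BoundedInstance 𝒳 A)
    (hsel : TemperedSelection 𝒳 x i S) (hδ0 : 0 < δ) (hδ1 : δ < 1 / 2)
    (hconf : Confident A x S (Real.log (8 * (1 : ℕ) / δ))) (k : Fin 1) {t : ℕ} (ht : 1 ≤ t) :
    pseudoRegret 𝒳 (A k) x t ≤ 36 * (d : ℝ) * √((d : ℝ) * t) * Real.log (t + 1) ^ 2 +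
      45 * √((d : ℝ) * t) * Real.log (t + 1) * Real.log (8 / δ) := by
  have h4 := log_level_ge le_rfl hδ0 hδ1
  have h1 := hconf.sum_signalLevel_sub_le hd hbdd hsel (by linarith) ht
  have h3 := log_two_le_log_succ ht
  have hd' : (1 : ℝ) ≤ d := by exact_mod_cast hd
  rw [pseudoRegret_eq k x i]
  refine h1.trans ?_
  rw [Nat.cast_one, mul_one] at h4 ⊢
  generalize Real.log ((t : ℝ) + 1) = l at *
  generalize Real.log (8 / δ) = ℓ at *
  -- Here l = log(t + 1) ≥ log 2 already at t = 1, so the first round needs no separate case.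
  have key : 10 * (d * l) + 4 * ℓ ≤ 36 * d * l ^ 2 + 45 * l * ℓ := by
    have e1 : 0.69 * (d * l) ≤ d * l ^ 2 := by
      nlinarith [mul_nonneg (zero_le_one.trans hd') (show 0 ≤ l by linarith)]
    have e2 : 0.69 * ℓ ≤ l * ℓ := by nlinarith
    nlinarith
  have := mul_le_mul_of_nonneg_left key (Real.sqrt_nonneg ((d : ℝ) * t))
  linarith

end Conclusion

/-- Uses only monotonicity and subadditivity, so the good event `E` need not be shown measurable. -/
lemma one_sub_le_measureReal {Ω : Type*} [MeasurableSpace Ω] {μ : Measure Ω}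
    [IsProbabilityMeasure μ] {E B : Set Ω} (h : ∀ ω, ω ∉ B → ω ∈ E) {ε : ℝ} (hε : 0 ≤ ε)
    (hB : μ B ≤ ENNReal.ofReal ε) : 1 - ε ≤ μ.real E := by
  have h1 : μ.real Set.univ ≤ μ.real E + μ.real B :=
    (measureReal_mono fun ω _ => (em (ω ∈ B)).symm.imp_left (h ω)).trans (measureReal_union_le _ _)
  have h2 : μ.real B ≤ ε := ENNReal.toReal_le_of_le_ofReal hε hB
  rw [probReal_univ] at h1
  linarith

end TemperedTest

theorem mainTheorem5 {Ω : Type*} [mΩ : MeasurableSpace Ω] (μ : Measure Ω) [IsProbabilityMeasure μ]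
    (m d : ℕ) (hd : 1 ≤ d)
    (𝒳 : Set (EuclideanSpace ℝ (Fin d))) (A : Matrix (Fin m) (Fin d) ℝ)
    (hbdd : TemperedTest.BoundedInstance 𝒳 A)
    (𝒢 : Filtration ℕ mΩ)
    (x : ℕ → Ω → EuclideanSpace ℝ (Fin d)) (i : ℕ → Ω → Fin m)
    (S : ℕ → Ω → EuclideanSpace ℝ (Fin m))
    (hint : TemperedTest.BanditInteraction μ 𝒢 A x i S)
    (hsel : ∀ ω, TemperedTest.TemperedSelection 𝒳 (fun t => x t ω) (fun t => i t ω)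
      (fun t => S t ω))
    (δ : ℝ) (hδ0 : 0 < δ) (hδ1 : δ < 1 / 2) :
    (TemperedTest.Feasible 𝒳 A →
      1 - δ ≤ μ.real {ω | ∀ t : ℕ, 1 ≤ t →
        (t : ℝ) * TemperedTest.signalLevel 𝒳 A - TemperedTest.boundaryF m d t δ ≤
          TemperedTest.statistic (fun s => i s ω) (fun s => S s ω) t}) ∧
    (TemperedTest.Infeasible 𝒳 A →
      1 - δ ≤ μ.real {ω | ∀ t : ℕ, 1 ≤ t →
        TemperedTest.statistic (fun s => i s ω) (fun s => S s ω) t ≤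
          (t : ℝ) * TemperedTest.signalLevel 𝒳 A + TemperedTest.boundaryI m d t δ}) ∧
    (m = 1 → ∀ k : Fin m,
      1 - δ / 2 ≤ μ.real {ω | ∀ t : ℕ, 1 ≤ t →
        TemperedTest.pseudoRegret 𝒳 (A k) (fun s => x s ω) t ≤
          36 * (d : ℝ) * √((d : ℝ) * t) * Real.log (t + 1) ^ 2 +
            45 * √((d : ℝ) * t) * Real.log (t + 1) * Real.log (8 / δ)}) := by
  obtain ⟨ω₀⟩ : Nonempty Ω := μ.nonempty_of_neZero
  have hm : 1 ≤ m := Nat.one_le_iff_ne_zero.2 fun h => (h ▸ i 0 ω₀).elim0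
  have hC := hint.measure_not_confident_le hm hδ0
  -- The confidence event may fail with probability δ/8, the noise bound with 7δ/8.
  have hbudget : ENNReal.ofReal (δ / 8) + ENNReal.ofReal (7 / 8 * δ) = ENNReal.ofReal δ := by
    rw [← ENNReal.ofReal_add (by positivity) (by positivity)]
    ring_nf
  refine ⟨fun _ => ?_, fun _ => ?_, ?_⟩
  · have hN := TemperedTest.measure_exists_noiseThreshold_le (𝒢 := 𝒢)
      -- The lower bound on the statistic needs the upper tail of the negated noise.
      (ζ := fun t ω => -TemperedTest.noise A x S t ω (i t ω))
      (fun t ht => (hint.measurable_noise_selected ht).neg)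
      (fun t ht => (hint.condSubGaussian_selected ht).neg) hδ0 hδ1
    refine TemperedTest.one_sub_le_measureReal (fun ω hω t ht => ?_) hδ0.le
      ((measure_union_le _ _).trans ((add_le_add hC hN).trans_eq hbudget))
    simp only [Set.mem_union, Set.mem_ofPred_eq, not_or, not_not, not_exists, not_and,
      not_le, Finset.sum_neg_distrib] at hω
    exact TemperedTest.le_statistic_of_confident hd hbdd (hsel ω) hδ0 hδ1 hω.1 hω.2 ht
  · have hN := TemperedTest.measure_exists_noiseThreshold_le (𝒢 := 𝒢)
      (ζ := fun t ω => TemperedTest.noise A x S t ω (i t ω))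
      (fun t ht => hint.measurable_noise_selected ht)
      (fun t ht => hint.condSubGaussian_selected ht) hδ0 hδ1
    refine TemperedTest.one_sub_le_measureReal (fun ω hω t ht => ?_) hδ0.le
      ((measure_union_le _ _).trans ((add_le_add hC hN).trans_eq hbudget))
    simp only [Set.mem_union, Set.mem_ofPred_eq, not_or, not_not, not_exists, not_and,
      not_le] at hω
    exact TemperedTest.statistic_le_of_confident hd hbdd (hsel ω) hδ0 hδ1 hω.1 hω.2 ht
  · rintro rfl k
    refine TemperedTest.one_sub_le_measureReal (fun ω hω t ht => ?_) (by positivity)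
      -- The confidence event alone is used, and δ/8 ≤ δ/2.
      (hC.trans (ENNReal.ofReal_le_ofReal (by linarith)))
    simp only [Set.mem_ofPred_eq, not_not] at hω
    exact TemperedTest.pseudoRegret_le_of_confident hd hbdd (hsel ω) hδ0 hδ1 hω k ht
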